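/- Let $f\in\mathcal C^3(\mathbb R;\mathbb R)$ with $f(1)=0$ and $f'(1)<0$. Set $c_s=\sqrt{-2f'(1)}$ and $F(\rho)=\int_\rho^1 f(r)\,dr$. Define $$\mathcal X^1=\{u\in H^1_{\rm loc}(\mathbb R;\mathbb C): u'\in L^2(\mathbb R),\ F(|u|^2)\in L^1(\mathbb R)\},\qquad \mathcal{NX}^1=\{u\in\mathcal X^1:\inf_{\mathbb R}|u|>0\},$$ where functions in $H^1_{\rm loc}(\mathbb R)$ are identified with their continuous representatives, and $$E(u)=\tfrac12\int_{\mathbb R}|u'|^2+\tfrac12\int_{\mathbb R}F(|u|^2),\qquad p(u)=\tfrac12\int_{\mathbb R}\mathrm{Re}\big(u\,\overline{iu'}\big)\Big(1-\frac1{|u|^2}\Big)\quad(u\in\mathcal{NX}^1),$$ $$E_{\min}(\mathfrak p)=\inf\{E(v): v\in\mathcal{NX}^1,\ p(v)=\mathfrak p\}\quad(\mathfrak p\in\mathbb R),$$ $$\mathfrak q_*=\sup\{\mathfrak q>0:\ \forall v\in\mathcal X^1,\ E(v)\le E_{\min}(\mathfrak q)\Rightarrow \inf_{\mathbb R}|v|>0\},$$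 the last supremum being taken in the extended reals. Assume (H1) $\frac{c_s^2}{4}(1-\rho)^2\le F(\rho)$ for all $\rho\ge0$; (H2) there are $M\ge0$ and $r\in[2,+\infty)$ such that $F(\rho)\le M|1-\rho|^r$ for all $\rho\ge2$. Then for every $\mathfrak p\in\mathbb R$ the set defining $E_{\min}(\mathfrak p)$ is non-empty, and the following hold. (i) $E_{\min}$ is nonnegative and even on $\mathbb R$, and $|E_{\min}(\mathfrak p)-E_{\min}(\mathfrak q)|\le c_s|\mathfrak p-\mathfrak q|$ for all $\mathfrak p,\mathfrak q\in\mathbb R$. (ii) $E_{\min}$ is nondecreasing and concave on $[0,+\infty)$, and strictly increasing on $\{\mathfrak q\in\mathbb R: 0\le\mathfrak q\le\mathfrak q_*\}$. Suppose in addition that (H3) $f''(1)+3f'(1)\ne0$. Then: (iii) There are constants $\mathfrak q_0,K_0,K_1,K_2>0$ such that for all $\mathfrak q\in[0,\mathfrak q_0]$ $$c_s\mathfrak q-K_0\mathfrak q^{5/3}\le E_{\min}(\mathfrak q)\le c_s\mathfrak q-K_1\mathfrak q^{5/3}+K_2\mathfrak q^{7/3}.$$ (iv) $E_{\min}$ is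 strictly subadditive: $E_{\min}(\mathfrak p+\mathfrak q)<E_{\min}(\mathfrak p)+E_{\min}(\mathfrak q)$ for all $\mathfrak p,\mathfrak q\in\mathbb R\setminus\{0\}$. -/

import Mathlib

open MeasureTheory
open scoped ContDiff

namespace NLS

noncomputable section

/-- `g` is a weak (distributional) derivative of `u` on the real line. -/
def HasWeakDeriv (u g : ℝ → ℂ) : Prop :=
  LocallyIntegrable u ∧ LocallyIntegrable g ∧
    ∀ φ : ℝ → ℝ, ContDiff ℝ ∞ φ → HasCompactSupport φ →
      ∫ x, deriv φ x • u x = - ∫ x, φ x • g x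

/-- Weak derivatives are unique almost everywhere. -/
theorem HasWeakDeriv.ae_unique {u g h : ℝ → ℂ}
    (hg : HasWeakDeriv u g) (hh : HasWeakDeriv u h) : g =ᵐ[volume] h := by
  have key : ∀ᵐ x ∂(volume : Measure ℝ), g x - h x = 0 := by
    refine ae_eq_zero_of_integral_contDiff_smul_eq_zero (hg.2.1.sub hh.2.1) ?_
    intro φ hφ hc
    have h1 : ∫ x, φ x • g x = ∫ x, φ x • h x := by
      have a := hg.2.2 φ hφ hc
      have b := hh.2.2 φ hφ hc
      exact neg_injective (a.symm.trans b)
    have i1 : Integrable (fun x => φ x • g x) :=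
      hg.2.1.integrable_smul_left_of_hasCompactSupport hφ.continuous hc
    have i2 : Integrable (fun x => φ x • h x) :=
      hh.2.1.integrable_smul_left_of_hasCompactSupport hφ.continuous hc
    have h2 : ∫ x, φ x • (g x - h x) = ∫ x, (φ x • g x - φ x • h x) := by
      simp only [smul_sub]
    rw [h2, integral_sub i1 i2, h1, sub_self]
  filter_upwards [key] with x hx using sub_eq_zero.mp hx

open Classical in
/-- The weak derivative `u'` of `u` (a representative of it), with value `0` if there is none. -/
def weakDeriv (u : ℝ → ℂ) : ℝ → ℂ :=
  if h : ∃ g, HasWeakDeriv u g then h.choose else 0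

theorem HasWeakDeriv.weakDeriv_ae_eq {u g : ℝ → ℂ} (hg : HasWeakDeriv u g) :
    weakDeriv u =ᵐ[volume] g := by
  have h : ∃ g, HasWeakDeriv u g := ⟨g, hg⟩
  have e : weakDeriv u = h.choose := dif_pos h
  rw [e]
  exact h.choose_spec.ae_unique hg

/-- `u ∈ L²_loc(ℝ)`. -/
def MemL2loc (u : ℝ → ℂ) : Prop :=
  ∀ K : Set ℝ, IsCompact K → MemLp u 2 (volume.restrict K)

/-- `u ∈ H¹_loc(ℝ)`: `u` and its weak derivative are in `L²_loc(ℝ)`. -/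
def MemH1loc (u : ℝ → ℂ) : Prop :=
  MemL2loc u ∧ ∃ g, HasWeakDeriv u g ∧ MemL2loc g

/-- `F(ρ) = ∫_ρ^1 f(r) dr`. -/
def F (f : ℝ → ℝ) (ρ : ℝ) : ℝ := ∫ r in ρ..1, f r

/-- The speed of sound `c_s = √(-2 f'(1))`. -/
def soundSpeed (f : ℝ → ℝ) : ℝ := Real.sqrt (-2 * deriv f 1)

/-- The energy set `𝒳¹(ℝ)`. A function of class `H¹_loc` on the line is identified with its
continuous representative. -/
def X1 (f : ℝ → ℝ) : Set (ℝ → ℂ) :=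
  {u | Continuous u ∧ MemH1loc u ∧ MemLp (weakDeriv u) 2 volume ∧
    Integrable (fun x => F f (‖u x‖ ^ 2))}

/-- The set `𝒩𝒳¹(ℝ)` of the functions of `𝒳¹(ℝ)` that stay away from zero. -/
def NX1 (f : ℝ → ℝ) : Set (ℝ → ℂ) :=
  {u | u ∈ X1 f ∧ 0 < ⨅ x, ‖u x‖}

/-- The energy `E(u) = ½ ∫ |u'|² + ½ ∫ F(|u|²)`. -/
def energy (f : ℝ → ℝ) (u : ℝ → ℂ) : ℝ :=
  (1 / 2) * (∫ x, ‖weakDeriv u x‖ ^ 2) + (1 / 2) * ∫ x, F f (‖u x‖ ^ 2)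

/-- The renormalized momentum `p(u) = ½ ∫ ⟨u, i u'⟩ (1 - 1/|u|²)`, where
`⟨z, w⟩ = Re (z w̄)`; for `u = ρ e^{iφ}` the integrand is `(1 - ρ²) φ'`. -/
def momentum (u : ℝ → ℂ) : ℝ :=
  (1 / 2) * ∫ x, inner ℝ (u x) (Complex.I * weakDeriv u x) * (1 - 1 / ‖u x‖ ^ 2)

/-- The minimization curve: the infimum of the energy at fixed momentum. -/
def Emin (f : ℝ → ℝ) (p : ℝ) : ℝ :=
  sInf {e | ∃ v ∈ NX1 f, momentum v = p ∧ e = energy f v}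

/-- `𝔮_* = sup {q > 0 | ∀ v ∈ 𝒳¹(ℝ), E(v) ≤ E_min(q) → inf |v| > 0}`, a supremum taken in the
extended reals. -/
def qStar (f : ℝ → ℝ) : EReal :=
  sSup ((fun q : ℝ => (q : EReal)) ''
    {q : ℝ | 0 < q ∧ ∀ v ∈ X1 f, energy f v ≤ Emin f q → 0 < ⨅ x, ‖v x‖})

end

end NLS

namespace NLS

/-! Write a nonvanishing function as `u = ρ e^{iθ}` with `w = θ'` and `η = 1 - ρ²`. Energy and
momentum become the integrals of `(ρ'² + ρ²w² + F(ρ²))/2` and `ηw/2`. Only `w`, never the phase,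
enters, so data can be cut, reflected and glued wherever the moduli agree (`attained_iff`,
`HalfAttained.join`).

Cutting off at modulus one and gluing gives subadditivity of `E_min`. Splitting a momentum into
small pieces then gives `E_min(p) ≤ c_s|p|`, hence the Lipschitz bound. Cutting one datum at a point
and doubling each half by reflection (`Attained.reflect`) gives midpoint concavity. A nonnegative
concave function on the half-line is nondecreasing.

If `E_min` were not strictly increasing up to `q_*`, it would be constant from some point on. The
black soliton vanishes at a point and has energy at most `2 ∫₀¹ √F(t²) dt`, so the constant would
exceed this value as soon as no larger momentum below it is available. Indeed, energies bounded away
below this value keep the modulus away from zero and so bound the momentum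
(`exists_momentum_bound`), which is incompatible with a constant value below it. A value at or above
it contradicts the definition of `q_*`.

Near zero, a long wave of amplitude `t²` and width of order `1/t` has momentum of order `t³` and
gains order `t⁵` over the sonic line, through the cubic part of `ρ²w²` (`exists_attained_small`).
Conversely, completing a square bounds the defect below the sonic line by `sup|η|` times the energy,
and Agmon's inequality gives `sup|η| ≲ q^{2/3}` (`exists_sonic_lower_bound`).

Equality in subadditivity for positive momenta would make `E_min` linear near zero. Its slope would
be below `c_s` by the upper bound and at least `c_s` by the lower one. -/

theorem intervalIntegrable_of_locallyIntegrable {E : Type*} [NormedAddCommGroup E] {g : ℝ → E}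
    (hg : LocallyIntegrable g) (a b : ℝ) :
    IntervalIntegrable g volume a b :=
  intervalIntegrable_iff.mpr <|
    (hg.integrableOn_isCompact isCompact_uIcc).mono_set Set.uIoc_subset_uIcc

theorem locallyIntegrable_of_intervalIntegrable {E : Type*} [NormedAddCommGroup E] {g : ℝ → E}
    (hg : ∀ a b, IntervalIntegrable g volume a b) : LocallyIntegrable g := by
  rw [locallyIntegrable_iff]
  intro K hK
  obtain ⟨R, hR⟩ := hK.isBounded.subset_closedBall 0
  refine IntegrableOn.mono_set (t := Set.Icc (-|R|) |R|) ?_ ?_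
  · have := (hg (-|R|) |R|).1
    rwa [← integrableOn_Icc_iff_integrableOn_Ioc] at this
  · intro x hx
    have := hR hx
    rw [Metric.mem_closedBall, dist_zero_right, Real.norm_eq_abs] at this
    exact abs_le.mp (this.trans (le_abs_self R))

theorem absolutelyContinuousOnInterval_lipschitz_comp {E E' : Type*}
    [NormedAddCommGroup E] [NormedAddCommGroup E']
    {u : ℝ → E} {φ : E → E'} {a b : ℝ} {K : NNReal} (hu : AbsolutelyContinuousOnInterval u a b)
    (hφ : LipschitzOnWith K φ (u '' Set.uIcc a b)) :
    AbsolutelyContinuousOnInterval (fun x => φ (u x)) a b := by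
  refine squeeze_zero' ?_ ?_ (by simpa using Filter.Tendsto.const_mul (K : ℝ) hu)
  · exact Filter.Eventually.of_forall fun _ => Finset.sum_nonneg fun _ _ => dist_nonneg
  rw [Filter.eventually_inf_principal]
  filter_upwards with I hI
  rw [Finset.mul_sum]
  refine Finset.sum_le_sum fun i hi => ?_
  have := hI.1 i hi
  exact hφ.dist_le_mul _ ⟨_, this.1, rfl⟩ _ ⟨_, this.2, rfl⟩

/-! ### Calculus of primitives of locally integrable functions -/

section Primitive

variable {E : Type*} [NormedAddCommGroup E] [NormedSpace ℝ E]

/-- `u` is a primitive of the locally integrable function `g`. -/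
structure IsPrimitive (u g : ℝ → E) : Prop where
  locInt : LocallyIntegrable g
  eq_add : ∀ x, u x = u 0 + ∫ t in (0 : ℝ)..x, g t

namespace IsPrimitive

variable {u g : ℝ → E}

theorem intervalIntegrable (h : IsPrimitive u g) (a b : ℝ) : IntervalIntegrable g volume a b :=
  intervalIntegrable_of_locallyIntegrable h.locInt a b

theorem sub_eq (h : IsPrimitive u g) (a b : ℝ) : u b - u a = ∫ t in a..b, g t := by
  rw [h.eq_add a, h.eq_add b, add_sub_add_left_eq_sub,
    intervalIntegral.integral_interval_sub_left (h.intervalIntegrable _ _)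
      (h.intervalIntegrable _ _)]

theorem eq_fun (h : IsPrimitive u g) : u = fun x => u 0 + ∫ t in (0 : ℝ)..x, g t :=
  funext h.eq_add

theorem continuous (h : IsPrimitive u g) : Continuous u := by
  rw [h.eq_fun]
  exact continuous_const.add (intervalIntegral.continuous_primitive h.intervalIntegrable 0)

theorem ae_hasDerivAt [CompleteSpace E] (h : IsPrimitive u g) :
    ∀ᵐ x, HasDerivAt u (g x) x := by
  filter_upwards [LocallyIntegrable.ae_hasDerivAt_integral h.locInt] with x hx
  rw [h.eq_fun]
  exact (hx 0).const_add _

theorem absolutelyContinuous (h : IsPrimitive u g) (a b : ℝ) :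
    AbsolutelyContinuousOnInterval u a b := by
  have hn : IntervalIntegrable (fun x => ‖g x‖) volume a b := (h.intervalIntegrable a b).norm
  have hac := hn.absolutelyContinuousOnInterval_intervalIntegral (c := a) (by simp)
  refine squeeze_zero (fun _ => Finset.sum_nonneg fun _ _ => dist_nonneg) (fun I => ?_) hac
  refine Finset.sum_le_sum fun i _ => ?_
  have hn' := fun a b => (h.intervalIntegrable a b).norm
  rw [dist_comm, dist_eq_norm, h.sub_eq, dist_comm, dist_eq_norm,
    intervalIntegral.integral_interval_sub_left (hn' _ _) (hn' _ _)]
  exact intervalIntegral.norm_integral_le_abs_integral_norm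

/-- The difference from the integral of `g` is absolutely continuous with zero derivative almost
everywhere, hence constant. -/
theorem of_absolutelyContinuous [CompleteSpace E] (hg : LocallyIntegrable g)
    (hac : ∀ a b, AbsolutelyContinuousOnInterval u a b) (hd : ∀ᵐ x, HasDerivAt u (g x) x) :
    IsPrimitive u g := by
  refine ⟨hg, fun x => ?_⟩
  set G : ℝ → E := fun y => ∫ t in (0 : ℝ)..y, g t with hG
  have hGp : IsPrimitive G g := ⟨hg, fun y => by simp [hG]⟩
  obtain ⟨C, hC⟩ := ((hac 0 x).sub (hGp.absolutelyContinuous 0 x)).const_of_ae_hasDerivAt_zero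
    (by
      filter_upwards [hd, hGp.ae_hasDerivAt] with y h1 h2 _
      simpa using h1.sub h2)
  have h0 := hC 0 (by simp)
  have h1 := hC x (by simp)
  simp only [Pi.sub_apply, hG, intervalIntegral.integral_same, sub_zero] at h0 h1
  rw [h0, ← h1]; abel

theorem of_hasDerivAt [CompleteSpace E] (hd : ∀ x, HasDerivAt u (g x) x) (hg : Continuous g) :
    IsPrimitive u g := by
  refine ⟨hg.locallyIntegrable, fun x => ?_⟩
  rw [intervalIntegral.integral_eq_sub_of_hasDerivAt (fun y _ => hd y) (hg.intervalIntegrable _ _)]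
  abel

end IsPrimitive

/-- Scalar chain rule for primitives. -/
theorem IsPrimitive.comp_deriv [CompleteSpace E] {u g : ℝ → ℝ} {φ φ' : ℝ → E}
    (h : IsPrimitive u g) (hd : ∀ x, HasDerivAt φ (φ' x) x) (hc : Continuous φ') :
    IsPrimitive (fun x => φ (u x)) (fun x => g x • φ' (u x)) := by
  have hcd : ContDiff ℝ 1 φ := by
    rw [contDiff_one_iff_deriv]
    refine ⟨fun x => (hd x).differentiableAt, ?_⟩
    rwa [show deriv φ = φ' from funext fun x => (hd x).deriv]
  have hi : LocallyIntegrable fun x => g x • φ' (u x) := by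
    apply locallyIntegrable_of_intervalIntegrable
    intro a b
    exact (h.intervalIntegrable a b).smul_continuousOn (hc.comp h.continuous).continuousOn
  refine IsPrimitive.of_absolutelyContinuous hi (fun a b => ?_) ?_
  -- A `C¹` map is Lipschitz on a ball containing the compact image of `u`, which suffices for
  -- absolute continuity.
  · obtain ⟨R, hR⟩ := (isCompact_uIcc.image h.continuous : IsCompact (u '' Set.uIcc a b))
      |>.isBounded.subset_closedBall 0
    obtain ⟨K, hK⟩ := hcd.contDiffOn.exists_lipschitzOnWith (s := Metric.closedBall 0 R) (by simp)
      (convex_closedBall _ _) (isCompact_closedBall _ _)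
    exact absolutelyContinuousOnInterval_lipschitz_comp (h.absolutelyContinuous a b) (hK.mono hR)
  · filter_upwards [h.ae_hasDerivAt] with x hx
    exact (hd (u x)).scomp x hx

/-- Product rule for primitives. -/
theorem IsPrimitive.smul [CompleteSpace E] {r s : ℝ → ℝ} {u g : ℝ → E} (hr : IsPrimitive r s)
    (hu : IsPrimitive u g) : IsPrimitive (fun x => r x • u x) (fun x => r x • g x + s x • u x) := by
  refine IsPrimitive.of_absolutelyContinuous ?_ (fun a b => ?_) ?_
  · apply locallyIntegrable_of_intervalIntegrable
    intro a b
    exact ((hu.intervalIntegrable a b).continuousOn_smul hr.continuous.continuousOn).add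
      ((hr.intervalIntegrable a b).smul_continuousOn hu.continuous.continuousOn)
  · exact (hr.absolutelyContinuous a b).smul (hu.absolutelyContinuous a b)
  · filter_upwards [hr.ae_hasDerivAt, hu.ae_hasDerivAt] with x h1 h2 using h1.smul h2

end Primitive

/-! ### Weak derivatives and primitives -/

section Weak

/-- Integration by parts: `φ u` is a primitive of `φ g + φ' u` and vanishes at both ends of an
interval containing the support of `φ`. -/
theorem IsPrimitive.hasWeakDeriv {u g : ℝ → ℂ} (h : IsPrimitive u g) : HasWeakDeriv u g := by
  refine ⟨h.continuous.locallyIntegrable, h.locInt, fun φ hφ hc => ?_⟩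
  have hφ1 : ∀ x, HasDerivAt φ (deriv φ x) x := fun x =>
    (hφ.differentiable (by simp) x).hasDerivAt
  have hφ2 : Continuous (deriv φ) := hφ.continuous_deriv (by simp)
  have hp := (IsPrimitive.of_hasDerivAt hφ1 hφ2).smul h
  obtain ⟨R, hR⟩ := hc.isBounded.subset_closedBall 0
  set r := |R| + 1
  have hz : ∀ x, r ≤ |x| → φ x = 0 := fun x hx => by
    apply image_eq_zero_of_notMem_tsupport
    intro hx'
    have := hR hx'
    rw [Metric.mem_closedBall, dist_zero_right, Real.norm_eq_abs] at this
    linarith [le_abs_self R]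
  have hr : 0 ≤ r := by positivity
  have hi1 : Integrable fun x => φ x • g x :=
    h.locInt.integrable_smul_left_of_hasCompactSupport hφ.continuous hc
  have hi2 : Integrable fun x => deriv φ x • u x :=
    h.continuous.locallyIntegrable.integrable_smul_left_of_hasCompactSupport hφ2 hc.deriv
  have hs : Function.support (fun x => φ x • g x + deriv φ x • u x) ⊆ Set.Ioc (-r) r := by
    intro x hx
    by_contra hx'
    apply hx
    have h3 : |R| < |x| := by
      by_contra h4
      push Not at h4
      apply hx'
      have := abs_le.mp h4
      constructor <;> simp only [r] <;> linarith
    have h5 : x ∉ tsupport φ := fun h6 => by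
      have := hR h6
      rw [Metric.mem_closedBall, dist_zero_right, Real.norm_eq_abs] at this
      linarith [le_abs_self R]
    have h6 : φ x = 0 := image_eq_zero_of_notMem_tsupport h5
    have h7 : deriv φ x = 0 :=
      image_eq_zero_of_notMem_tsupport fun h8 => h5 (tsupport_deriv_subset h8)
    simp [h6, h7]
  have key : ∫ x, (φ x • g x + deriv φ x • u x) = 0 := by
    rw [← intervalIntegral.integral_eq_integral_of_support_subset hs, ← hp.sub_eq]
    rw [hz r (le_abs_self r), hz (-r) (by rw [abs_neg]; exact le_abs_self r)]
    simp
  rw [integral_add hi1 hi2] at key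
  exact eq_neg_of_add_eq_zero_right key

/-- A continuous function whose distributional derivative vanishes is constant. -/
theorem eq_const_of_integral_deriv_smul_eq_zero {u : ℝ → ℂ} (hu : Continuous u)
    (h : ∀ φ : ℝ → ℝ, ContDiff ℝ ∞ φ → HasCompactSupport φ → ∫ x, deriv φ x • u x = 0) :
    ∃ c, ∀ x, u x = c := by
  let χ : ContDiffBump (0 : ℝ) := ⟨1, 2, one_pos, one_lt_two⟩
  set k : ℝ → ℝ := χ.normed volume with hk
  have hk1 : ContDiff ℝ ∞ k := χ.contDiff_normed
  have hk2 : HasCompactSupport k := χ.hasCompactSupport_normed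
  have hk3 : ∫ x, k x = 1 := χ.integral_normed
  set c : ℂ := ∫ x, k x • u x with hc
  refine ⟨c, ?_⟩
  have hae : ∀ᵐ x, u x - c = 0 := by
    refine ae_eq_zero_of_integral_contDiff_smul_eq_zero
      (hu.sub continuous_const).locallyIntegrable ?_
    intro ψ hψ hψc
    set m : ℝ := ∫ x, ψ x with hm
    set θ : ℝ → ℝ := fun x => ψ x - m * k x with hθ
    have hθ1 : ContDiff ℝ ∞ θ := hψ.sub (contDiff_const.mul hk1)
    have hθ2 : HasCompactSupport θ := hψc.sub hk2.mul_left
    have hψi : Integrable ψ := hψ.continuous.integrable_of_hasCompactSupport hψc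
    have hki : Integrable k := hk1.continuous.integrable_of_hasCompactSupport hk2
    have hθ0 : ∫ x, θ x = 0 := by
      simp only [hθ]
      rw [integral_sub hψi (hki.const_mul m), integral_const_mul, hk3, ← hm]; ring
    obtain ⟨R, hR⟩ := hθ2.isBounded.subset_closedBall 0
    have hz : ∀ x, |R| < |x| → θ x = 0 := fun x hx => by
      apply image_eq_zero_of_notMem_tsupport
      intro hx'
      have := hR hx'
      rw [Metric.mem_closedBall, dist_zero_right, Real.norm_eq_abs] at this
      linarith [le_abs_self R]
    set r := |R| + 1 with hr
    have hr0 : |R| < r := by linarith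
    have hrp : 0 < r := by positivity
    set φ : ℝ → ℝ := fun x => ∫ t in (-r)..x, θ t with hφ
    have hd : ∀ x, HasDerivAt φ (θ x) x := fun x =>
      intervalIntegral.integral_hasDerivAt_right (hθ1.continuous.intervalIntegrable _ _)
        (hθ1.continuous.stronglyMeasurableAtFilter _ _) hθ1.continuous.continuousAt
    have hde : deriv φ = θ := funext fun x => (hd x).deriv
    have hφ1 : ContDiff ℝ ∞ φ := by
      rw [contDiff_infty_iff_deriv, hde]
      exact ⟨fun x => (hd x).differentiableAt, hθ1⟩
    have hsupp : Function.support θ ⊆ Set.Ioc (-r) r := by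
      intro x hx
      by_contra hx'
      refine hx (hz x ?_)
      by_contra h4
      push Not at h4
      have := abs_le.mp h4
      exact hx' ⟨by linarith, by linarith⟩
    have hφr : φ r = 0 := by
      simp only [hφ]
      rw [intervalIntegral.integral_eq_integral_of_support_subset hsupp, hθ0]
    have hφ2 : HasCompactSupport φ := by
      refine HasCompactSupport.intro (isCompact_Icc (a := -r) (b := r)) fun x hx => ?_
      rw [Set.mem_Icc, not_and_or, not_le, not_le] at hx
      rcases hx with hx | hx
      · simp only [hφ]
        rw [intervalIntegral.integral_symm, intervalIntegral.integral_zero_ae, neg_zero]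
        refine Filter.Eventually.of_forall fun t ht => hz t ?_
        rw [Set.uIoc_of_le hx.le] at ht
        have ht2 := ht.2
        by_contra h4
        push Not at h4
        linarith [(abs_le.mp h4).1]
      · have hadd : φ x = φ r + ∫ t in r..x, θ t := by
          simp only [hφ]
          rw [intervalIntegral.integral_add_adjacent_intervals] <;>
            exact hθ1.continuous.intervalIntegrable _ _
        rw [hadd, hφr, intervalIntegral.integral_zero_ae, add_zero]
        refine Filter.Eventually.of_forall fun t ht => hz t ?_
        rw [Set.uIoc_of_le hx.le] at ht
        have ht2 := ht.1
        linarith [le_abs_self t]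
    have h0 := h φ hφ1 hφ2
    rw [hde] at h0
    have i1 : Integrable fun x => ψ x • u x :=
      hu.locallyIntegrable.integrable_smul_left_of_hasCompactSupport hψ.continuous hψc
    have i2 : Integrable fun x => k x • u x :=
      hu.locallyIntegrable.integrable_smul_left_of_hasCompactSupport hk1.continuous hk2
    have e1 : ∫ x, θ x • u x = (∫ x, ψ x • u x) - m • c := by
      rw [hc, ← integral_smul, ← integral_sub i1
          (f := fun x => ψ x • u x) (g := fun x => m • k x • u x) (i2.smul m)]
      simp only [hθ, sub_smul, mul_smul]
    have e2 : ∫ x, ψ x • (u x - c) = (∫ x, ψ x • u x) - m • c := by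
      rw [hm, ← integral_smul_const, ← integral_sub i1 (hψi.smul_const c)]
      simp only [smul_sub]
    rw [e2, ← e1, h0]
  have := (Continuous.ae_eq_iff_eq volume hu (continuous_const (y := c))).mp
    (hae.mono fun x hx => sub_eq_zero.mp hx)
  exact fun x => congrFun this x

/-- Subtracting the integral of `g` leaves a continuous function with zero distributional
derivative, hence a constant. -/
theorem HasWeakDeriv.isPrimitive {u g : ℝ → ℂ} (h : HasWeakDeriv u g) (hu : Continuous u) :
    IsPrimitive u g := by
  set G : ℝ → ℂ := fun y => ∫ t in (0 : ℝ)..y, g t with hG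
  have hGp : IsPrimitive G g := ⟨h.2.1, fun y => by simp [hG]⟩
  obtain ⟨c, hc⟩ := eq_const_of_integral_deriv_smul_eq_zero (hu.sub hGp.continuous) (by
    intro φ hφ hφc
    have hφ2 : Continuous (deriv φ) := hφ.continuous_deriv (by simp)
    have i1 := hu.locallyIntegrable.integrable_smul_left_of_hasCompactSupport hφ2 hφc.deriv
      (μ := volume)
    have i2 := hGp.continuous.locallyIntegrable.integrable_smul_left_of_hasCompactSupport hφ2
      hφc.deriv (μ := volume)
    simp only [Pi.sub_apply, smul_sub]
    rw [integral_sub i1 i2, h.2.2 φ hφ hφc, hGp.hasWeakDeriv.2.2 φ hφ hφc, sub_self])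
  refine ⟨h.2.1, fun x => ?_⟩
  have h0 := hc 0
  have h1 := hc x
  simp only [Pi.sub_apply, hG, intervalIntegral.integral_same, sub_zero] at h0 h1
  rw [h0, ← h1]; abel

end Weak

/-! ### Hydrodynamic variables -/

/-- The standing assumptions on the nonlinearity. -/
structure Admissible (f : ℝ → ℝ) : Prop where
  contDiff : ContDiff ℝ 3 f
  map_one : f 1 = 0
  deriv_neg : deriv f 1 < 0
  lower : ∀ ρ : ℝ, 0 ≤ ρ → soundSpeed f ^ 2 / 4 * (1 - ρ) ^ 2 ≤ F f ρ

namespace Admissible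

variable {f : ℝ → ℝ}

theorem soundSpeed_pos (hf : Admissible f) : 0 < soundSpeed f :=
  Real.sqrt_pos.mpr (by linarith [hf.deriv_neg])

theorem soundSpeed_sq (hf : Admissible f) : soundSpeed f ^ 2 = -2 * deriv f 1 :=
  Real.sq_sqrt (by linarith [hf.deriv_neg])

theorem F_nonneg (hf : Admissible f) {ρ : ℝ} (h : 0 ≤ ρ) : 0 ≤ F f ρ :=
  le_trans (by positivity) (hf.lower ρ h)

theorem hasDerivAt_F (hf : Admissible f) (x : ℝ) : HasDerivAt (F f) (-f x) x := by
  have hc := hf.contDiff.continuous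
  exact intervalIntegral.integral_hasDerivAt_left (hc.intervalIntegrable _ _)
    (hc.stronglyMeasurableAtFilter _ _) hc.continuousAt

theorem continuous_F (hf : Admissible f) : Continuous (F f) :=
  continuous_iff_continuousAt.mpr fun x => (hf.hasDerivAt_F x).continuousAt

end Admissible

@[simp] theorem F_one (f : ℝ → ℝ) : F f 1 = 0 := by simp [F]

/-- `ρ` is the modulus, `σ` its derivative and `w` the derivative of the phase of a function
in `NX1 f`. -/
structure IsHydro (f ρ σ w : ℝ → ℝ) : Prop where
  prim : IsPrimitive ρ σ
  memLp_deriv : MemLp σ 2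
  memLp_velocity : MemLp (fun x => ρ x * w x) 2
  pos : ∃ δ > 0, ∀ x, δ ≤ ρ x
  int_F : Integrable fun x => F f (ρ x ^ 2)

/-- The energy density in hydrodynamic variables. -/
noncomputable def energyDensity (f ρ σ w : ℝ → ℝ) (x : ℝ) : ℝ :=
  (σ x ^ 2 + (ρ x * w x) ^ 2 + F f (ρ x ^ 2)) / 2

/-- The momentum density in hydrodynamic variables. -/
noncomputable def momentumDensity (ρ w : ℝ → ℝ) (x : ℝ) : ℝ := (1 - ρ x ^ 2) * w x / 2

namespace IsHydro

variable {f ρ σ w : ℝ → ℝ}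

theorem rho_pos (h : IsHydro f ρ σ w) (x : ℝ) : 0 < ρ x := by
  obtain ⟨δ, h0, h1⟩ := h.pos
  exact h0.trans_le (h1 x)

theorem continuous (h : IsHydro f ρ σ w) : Continuous ρ := h.prim.continuous

theorem integrable_energyDensity (h : IsHydro f ρ σ w) : Integrable (energyDensity f ρ σ w) :=
  ((h.memLp_deriv.integrable_sq.add h.memLp_velocity.integrable_sq).add h.int_F).div_const 2

theorem memLp_w (h : IsHydro f ρ σ w) : MemLp w 2 := by
  obtain ⟨δ, h0, h1⟩ := h.pos
  have hw : w = fun x => (ρ x)⁻¹ * (ρ x * w x) := by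
    funext x
    have := (h.rho_pos x).ne'
    field_simp
  have hm : AEStronglyMeasurable w volume := by
    rw [hw]
    exact (h.continuous.inv₀ fun x => (h.rho_pos x).ne').aestronglyMeasurable.mul
      h.memLp_velocity.aestronglyMeasurable
  refine h.memLp_velocity.of_le_mul (c := δ⁻¹) hm (Filter.Eventually.of_forall fun x => ?_)
  rw [norm_mul, Real.norm_of_nonneg (h.rho_pos x).le, inv_mul_eq_div, le_div_iff₀ h0, mul_comm]
  exact mul_le_mul_of_nonneg_right (h1 x) (norm_nonneg _)

theorem integrable_eta_sq (hf : Admissible f) (h : IsHydro f ρ σ w) :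
    Integrable fun x => (1 - ρ x ^ 2) ^ 2 := by
  have hc := hf.soundSpeed_pos
  refine (h.int_F.const_mul (4 / soundSpeed f ^ 2)).mono'
    (by have := h.continuous; fun_prop) (Filter.Eventually.of_forall fun x => ?_)
  have := hf.lower (ρ x ^ 2) (sq_nonneg _)
  rw [Real.norm_of_nonneg (sq_nonneg _), div_mul_eq_mul_div, le_div_iff₀ (by positivity)]
  linarith

theorem memLp_eta (hf : Admissible f) (h : IsHydro f ρ σ w) : MemLp (fun x => 1 - ρ x ^ 2) 2 :=
  (memLp_two_iff_integrable_sq (by have := h.continuous; fun_prop)).mpr (h.integrable_eta_sq hf)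

theorem integrable_momentumDensity (hf : Admissible f) (h : IsHydro f ρ σ w) :
    Integrable (momentumDensity ρ w) :=
  ((h.memLp_eta hf).integrable_mul h.memLp_w).div_const 2

end IsHydro

theorem energyDensity_nonneg {f : ℝ → ℝ} (hf : Admissible f) (ρ σ w : ℝ → ℝ) (x : ℝ) :
    0 ≤ energyDensity f ρ σ w x := by
  have := hf.F_nonneg (sq_nonneg (ρ x))
  unfold energyDensity
  positivity

/-- `(e, p)` is the energy and the momentum of some hydrodynamic data. -/
def Attained (f : ℝ → ℝ) (e p : ℝ) : Prop :=
  ∃ ρ σ w : ℝ → ℝ, IsHydro f ρ σ w ∧ ∫ x, energyDensity f ρ σ w x = e ∧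
    ∫ x, momentumDensity ρ w x = p

theorem hasWeakDeriv_weakDeriv {u : ℝ → ℂ} (h : ∃ g, HasWeakDeriv u g) :
    HasWeakDeriv u (weakDeriv u) := by
  rw [weakDeriv, dif_pos h]
  exact h.choose_spec

/-- Pythagoras in the orthonormal frame `z/‖z‖`, `iz/‖z‖`. For `z = u`, `v = u'` the components are
the derivative of the modulus and the modulus times the phase derivative. -/
theorem norm_sq_eq_inner_add_inner {z v : ℂ} (hz : z ≠ 0) :
    ‖v‖ ^ 2 = (inner ℝ z v / ‖z‖) ^ 2 + (‖z‖ * (-inner ℝ z (Complex.I * v) / ‖z‖ ^ 2)) ^ 2 := by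
  have hz' : ‖z‖ ≠ 0 := norm_ne_zero_iff.mpr hz
  have h1 : (inner ℝ z v) ^ 2 + (inner ℝ z (Complex.I * v)) ^ 2 = ‖z‖ ^ 2 * ‖v‖ ^ 2 := by
    simp only [Complex.inner, ← Complex.normSq_eq_norm_sq, Complex.normSq_apply, Complex.mul_re,
      Complex.mul_im, Complex.conj_re, Complex.conj_im, Complex.I_re, Complex.I_im]
    ring
  field_simp
  linarith

/-- No phase has to be lifted: `w` is defined algebraically from `u` and `u'`, and only the modulus
must be recognised as a primitive. -/
theorem attained_of_mem_NX1 {f : ℝ → ℝ} {u : ℝ → ℂ} (hu : u ∈ NX1 f) :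
    Attained f (energy f u) (momentum u) := by
  obtain ⟨⟨hc, ⟨_, hg⟩, hL, hF⟩, hpos⟩ := hu
  have hw := hasWeakDeriv_weakDeriv (hg.imp fun _ h => h.1)
  set g := weakDeriv u with hg
  have hp := hw.isPrimitive hc
  set δ := ⨅ x, ‖u x‖ with hδ
  have hle : ∀ x, δ ≤ ‖u x‖ := fun x => ciInf_le ⟨0, by rintro _ ⟨x, rfl⟩; positivity⟩ x
  have hn : ∀ x, 0 < ‖u x‖ := fun x => hpos.trans_le (hle x)
  have hne : ∀ x, u x ≠ 0 := fun x => norm_pos_iff.mp (hn x)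
  set σ : ℝ → ℝ := fun x => inner ℝ (u x) (g x) / ‖u x‖ with hσ
  set w : ℝ → ℝ := fun x => -inner ℝ (u x) (Complex.I * g x) / ‖u x‖ ^ 2 with hwd
  have key : ∀ x, ‖g x‖ ^ 2 = σ x ^ 2 + (‖u x‖ * w x) ^ 2 := fun x =>
    norm_sq_eq_inner_add_inner (hne x)
  have hgm := hL.aestronglyMeasurable
  have hσL : MemLp σ 2 := by
    refine hL.mono ?_ (Filter.Eventually.of_forall fun x => ?_)
    · exact (hc.aestronglyMeasurable.inner hgm).mul
        (hc.norm.inv₀ fun x => (hn x).ne').aestronglyMeasurable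
    · refine abs_le_of_sq_le_sq ?_ (norm_nonneg _)
      rw [key x]; nlinarith [sq_nonneg (‖u x‖ * w x)]
  have hwL : MemLp (fun x => ‖u x‖ * w x) 2 := by
    refine hL.mono ?_ (Filter.Eventually.of_forall fun x => ?_)
    · refine hc.norm.aestronglyMeasurable.mul ?_
      exact (hc.aestronglyMeasurable.inner (hgm.const_mul Complex.I)).neg.mul
        ((hc.norm.pow 2).inv₀ fun x => (pow_pos (hn x) 2).ne').aestronglyMeasurable
    · refine abs_le_of_sq_le_sq ?_ (norm_nonneg _)
      rw [key x]; nlinarith [sq_nonneg (σ x)]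
  refine ⟨fun x => ‖u x‖, σ, w, ⟨?_, hσL, hwL, ⟨δ, hpos, hle⟩, hF⟩, ?_, ?_⟩
  · refine IsPrimitive.of_absolutelyContinuous (hσL.locallyIntegrable (by norm_num))
      (fun a b => ?_) ?_
    · exact absolutelyContinuousOnInterval_lipschitz_comp (hp.absolutelyContinuous a b)
        (lipschitzWith_one_norm.lipschitzOnWith)
    · filter_upwards [hp.ae_hasDerivAt] with x hx
      have h1 := (hx.norm_sq).sqrt (pow_pos (hn x) 2).ne'
      simp only [Real.sqrt_sq (norm_nonneg _)] at h1
      rwa [mul_div_mul_left _ _ two_ne_zero] at h1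
  · rw [energy, ← mul_add, ← integral_add hL.norm.integrable_sq hF, ← integral_const_mul]
    congr 1; ext x
    rw [key x, energyDensity]; ring
  · rw [momentum, ← integral_const_mul]
    congr 1; ext x
    have := (hn x).ne'
    simp only [momentumDensity, hwd]
    field_simp
    ring

/-- The phase is recovered by integrating `w`, which is locally integrable because `ρ` is bounded
below. -/
theorem exists_mem_NX1_of_isHydro {f ρ σ w : ℝ → ℝ} (h : IsHydro f ρ σ w) :
    ∃ u ∈ NX1 f, energy f u = ∫ x, energyDensity f ρ σ w x ∧
      momentum u = ∫ x, momentumDensity ρ w x := by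
  have hwl : LocallyIntegrable w := h.memLp_w.locallyIntegrable (by norm_num)
  set θ : ℝ → ℝ := fun x => ∫ t in (0 : ℝ)..x, w t with hθ
  have hθp : IsPrimitive θ w := ⟨hwl, fun x => by simp [hθ]⟩
  set e : ℝ → ℂ := fun x => Complex.exp (θ x * Complex.I) with he
  have hep : IsPrimitive e fun x => w x • (e x * Complex.I) := by
    refine hθp.comp_deriv (φ := fun s : ℝ => Complex.exp (s * Complex.I))
      (φ' := fun s : ℝ => Complex.exp (s * Complex.I) * Complex.I) (fun x => ?_) (by fun_prop)
    have h1 : HasDerivAt (fun s : ℝ => (s : ℂ) * Complex.I) Complex.I x := by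
      simpa using (Complex.ofRealCLM.hasDerivAt (x := x)).mul_const Complex.I
    exact h1.cexp
  set u : ℝ → ℂ := fun x => ρ x • e x with hu
  set g : ℝ → ℂ := fun x => ρ x • (w x • (e x * Complex.I)) + σ x • e x with hg
  have hup : IsPrimitive u g := h.prim.smul hep
  have hen : ∀ x, ‖e x‖ = 1 := fun x => Complex.norm_exp_ofReal_mul_I _
  have hun : ∀ x, ‖u x‖ = ρ x := fun x => by
    simp [hu, hen, abs_of_pos (h.rho_pos x)]
  have hg' : ∀ x, g x = ((σ x : ℂ) + (ρ x * w x : ℝ) * Complex.I) * e x := fun x => by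
    simp only [hg, Complex.real_smul]; push_cast; ring
  have hgn : ∀ x, ‖g x‖ ^ 2 = σ x ^ 2 + (ρ x * w x) ^ 2 := fun x => by
    rw [hg', norm_mul, hen, mul_one, Complex.sq_norm, Complex.normSq_add_mul_I]
  have hgL : MemLp g 2 := by
    rw [memLp_two_iff_integrable_sq_norm hup.locInt.aestronglyMeasurable]
    simp only [hgn]
    exact h.memLp_deriv.integrable_sq.add h.memLp_velocity.integrable_sq
  have hwd := hup.hasWeakDeriv
  have hae := hwd.weakDeriv_ae_eq
  obtain ⟨δ, h0, h1⟩ := h.pos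
  have hmem : u ∈ NX1 f := by
    refine ⟨⟨hup.continuous, ⟨fun K hK => ?_, g, hwd, fun K _ => hgL.restrict K⟩,
      (memLp_congr_ae hae).mpr hgL, ?_⟩, ?_⟩
    · rw [memLp_two_iff_integrable_sq_norm hup.continuous.aestronglyMeasurable]
      exact (hup.continuous.norm.pow 2).locallyIntegrable.integrableOn_isCompact hK
    · simpa only [hun] using h.int_F
    · refine h0.trans_le (le_ciInf fun x => ?_)
      rw [hun]; exact h1 x
  refine ⟨u, hmem, ?_, ?_⟩
  · have : ∫ x, ‖weakDeriv u x‖ ^ 2 = ∫ x, (σ x ^ 2 + (ρ x * w x) ^ 2) :=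
      integral_congr_ae (hae.mono fun x hx => by simp only [hx, hgn])
    rw [energy, this, ← mul_add]
    simp only [hun]
    rw [← integral_add (f := fun x => σ x ^ 2 + (ρ x * w x) ^ 2)
      (h.memLp_deriv.integrable_sq.add h.memLp_velocity.integrable_sq) h.int_F,
          ← integral_const_mul]
    congr 1; ext x; simp only [energyDensity]; ring
  · rw [momentum, ← integral_const_mul]
    refine integral_congr_ae (hae.mono fun x hx => ?_)
    have h2 : inner ℝ (u x) (Complex.I * g x) = -(ρ x ^ 2 * w x) := by
      have h3 : (e x).re * (e x).re + (e x).im * (e x).im = 1 := by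
        rw [← Complex.normSq_apply, Complex.normSq_eq_norm_sq, hen]; norm_num
      rw [hg']
      simp only [hu, Complex.inner, Complex.real_smul, Complex.mul_re, Complex.mul_im,
        Complex.conj_re, Complex.conj_im, Complex.I_re, Complex.I_im, Complex.ofReal_re,
        Complex.ofReal_im, Complex.add_re, Complex.add_im]
      linear_combination (-(ρ x ^ 2 * w x)) * h3
    have := (h.rho_pos x).ne'
    simp only [hx, h2, hun, momentumDensity]
    field_simp
    ring

theorem attained_iff {f : ℝ → ℝ} {e p : ℝ} :
    Attained f e p ↔ ∃ v ∈ NX1 f, momentum v = p ∧ e = energy f v := by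
  constructor
  · rintro ⟨ρ, σ, w, h, rfl, rfl⟩
    obtain ⟨u, hu, h1, h2⟩ := exists_mem_NX1_of_isHydro h
    exact ⟨u, hu, h2, h1.symm⟩
  · rintro ⟨v, hv, rfl, rfl⟩
    exact attained_of_mem_NX1 hv

theorem Emin_eq_sInf_attained (f : ℝ → ℝ) (p : ℝ) : Emin f p = sInf {e | Attained f e p} := by
  simp only [Emin, attained_iff]

/-! ### Reflecting, gluing and rescaling data -/

section Operations

open Set Filter Topology

variable {f ρ σ w : ℝ → ℝ}

theorem IsPrimitive.comp_neg {u g : ℝ → ℝ} (h : IsPrimitive u g) :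
    IsPrimitive (fun x => u (-x)) (fun x => -g (-x)) := by
  refine ⟨?_, fun x => ?_⟩
  · apply locallyIntegrable_of_intervalIntegrable
    intro a b
    have : IntervalIntegrable (fun x => g (-x)) volume a b := by
      simpa using (h.intervalIntegrable (-a) (-b)).comp_mul_left (c := (-1 : ℝ))
    exact this.neg
  · rw [intervalIntegral.integral_neg, intervalIntegral.integral_comp_neg (f := g), neg_zero,
      ← h.sub_eq]
    ring

theorem IsPrimitive.comp_add_right {u g : ℝ → ℝ} (h : IsPrimitive u g) (a : ℝ) :
    IsPrimitive (fun x => u (x + a)) (fun x => g (x + a)) := by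
  refine ⟨?_, fun x => ?_⟩
  · apply locallyIntegrable_of_intervalIntegrable
    intro b c
    simpa using (h.intervalIntegrable (b + a) (c + a)).comp_add_right a
  · rw [intervalIntegral.integral_comp_add_right, ← h.sub_eq]
    ring

theorem IsPrimitive.piecewise {u g v k : ℝ → ℝ} (hu : IsPrimitive u g) (hv : IsPrimitive v k)
    (h0 : u 0 = v 0) :
    IsPrimitive ((Iic (0 : ℝ)).piecewise u v) ((Iic (0 : ℝ)).piecewise g k) := by
  refine ⟨?_, fun x => ?_⟩
  · apply locallyIntegrable_of_intervalIntegrable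
    intro a b
    rw [intervalIntegrable_iff]
    have h1 := (intervalIntegrable_iff.mp (hu.intervalIntegrable a b))
    have h2 := (intervalIntegrable_iff.mp (hv.intervalIntegrable a b))
    exact Integrable.piecewise measurableSet_Iic
        (Integrable.mono_measure h1 Measure.restrict_le_self)
      (Integrable.mono_measure h2 Measure.restrict_le_self)
  · rw [Set.piecewise_eq_of_mem (i := (0 : ℝ)) _ _ _ (mem_Iic.mpr le_rfl)]
    rcases le_or_gt x 0 with hx | hx
    · rw [Set.piecewise_eq_of_mem _ _ _ (mem_Iic.mpr hx), hu.eq_add x]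
      congr 1
      refine intervalIntegral.integral_congr_ae (Eventually.of_forall fun t ht => ?_)
      rw [uIoc_of_ge hx] at ht
      rw [Set.piecewise_eq_of_mem _ _ _ (mem_Iic.mpr ht.2)]
    · rw [Set.piecewise_eq_of_notMem _ _ _ (notMem_Iic.mpr hx), hv.eq_add x, h0]
      congr 1
      refine intervalIntegral.integral_congr_ae (Eventually.of_forall fun t ht => ?_)
      rw [uIoc_of_le hx.le] at ht
      rw [Set.piecewise_eq_of_notMem _ _ _ (notMem_Iic.mpr ht.1)]

namespace IsHydro

theorem comp_neg (h : IsHydro f ρ σ w) :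
    IsHydro f (fun x => ρ (-x)) (fun x => -σ (-x)) (fun x => w (-x)) where
  prim := h.prim.comp_neg
  memLp_deriv := (h.memLp_deriv.comp_measurePreserving (Measure.measurePreserving_neg volume)).neg
  memLp_velocity := h.memLp_velocity.comp_measurePreserving (Measure.measurePreserving_neg volume)
  pos := by
    obtain ⟨δ, h0, h1⟩ := h.pos
    exact ⟨δ, h0, fun x => h1 _⟩
  int_F := h.int_F.comp_neg

theorem comp_add_right (h : IsHydro f ρ σ w) (a : ℝ) :
    IsHydro f (fun x => ρ (x + a)) (fun x => σ (x + a)) (fun x => w (x + a)) where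
  prim := h.prim.comp_add_right a
  memLp_deriv := h.memLp_deriv.comp_measurePreserving (measurePreserving_add_right volume a)
  memLp_velocity := h.memLp_velocity.comp_measurePreserving (measurePreserving_add_right volume a)
  pos := by
    obtain ⟨δ, h0, h1⟩ := h.pos
    exact ⟨δ, h0, fun x => h1 _⟩
  int_F := h.int_F.comp_add_right a

/-- Only the moduli must match at the junction; `w` is merely square integrable and may jump. -/
theorem piecewise {ρ' σ' w' : ℝ → ℝ} (h : IsHydro f ρ σ w) (h' : IsHydro f ρ' σ' w')
    (h0 : ρ 0 = ρ' 0) :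
    IsHydro f ((Iic (0 : ℝ)).piecewise ρ ρ') ((Iic (0 : ℝ)).piecewise σ σ')
      ((Iic (0 : ℝ)).piecewise w w') where
  prim := h.prim.piecewise h'.prim h0
  memLp_deriv := MemLp.piecewise measurableSet_Iic (h.memLp_deriv.restrict _)
    (h'.memLp_deriv.restrict _)
  memLp_velocity := by
    have he : (fun x => (Iic (0 : ℝ)).piecewise ρ ρ' x * (Iic (0 : ℝ)).piecewise w w' x) =
        (Iic (0 : ℝ)).piecewise (fun x => ρ x * w x) fun x => ρ' x * w' x := by
      ext x
      by_cases hx : x ∈ Iic (0 : ℝ) <;> simp only [Set.piecewise, hx, if_true, if_false]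
    rw [he]
    exact MemLp.piecewise measurableSet_Iic (h.memLp_velocity.restrict _)
      (h'.memLp_velocity.restrict _)
  pos := by
    obtain ⟨δ, h0, h1⟩ := h.pos
    obtain ⟨δ', h0', h1'⟩ := h'.pos
    refine ⟨min δ δ', lt_min h0 h0', fun x => ?_⟩
    by_cases hx : x ∈ Iic (0 : ℝ) <;> simp only [Set.piecewise, hx, if_true, if_false]
    exacts [(min_le_left _ _).trans (h1 x), (min_le_right _ _).trans (h1' x)]
  int_F := by
    have he : (fun x => F f ((Iic (0 : ℝ)).piecewise ρ ρ' x ^ 2)) =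
        (Iic (0 : ℝ)).piecewise (fun x => F f (ρ x ^ 2)) fun x => F f (ρ' x ^ 2) := by
      ext x
      by_cases hx : x ∈ Iic (0 : ℝ) <;> simp only [Set.piecewise, hx, if_true, if_false]
    rw [he]
    exact Integrable.piecewise measurableSet_Iic h.int_F.integrableOn h'.int_F.integrableOn

theorem mul_velocity (h : IsHydro f ρ σ w) (t : ℝ) : IsHydro f ρ σ (fun x => t * w x) where
  prim := h.prim
  memLp_deriv := h.memLp_deriv
  memLp_velocity := by
    have he : (fun x => ρ x * (t * w x)) = fun x => t * (ρ x * w x) := by ext x; ring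
    rw [he]
    exact h.memLp_velocity.const_mul t
  pos := h.pos
  int_F := h.int_F

end IsHydro

theorem energyDensity_piecewise (f ρ σ w ρ' σ' w' : ℝ → ℝ) :
    energyDensity f ((Iic (0 : ℝ)).piecewise ρ ρ') ((Iic (0 : ℝ)).piecewise σ σ')
      ((Iic (0 : ℝ)).piecewise w w') =
    (Iic (0 : ℝ)).piecewise (energyDensity f ρ σ w) (energyDensity f ρ' σ' w') := by
  ext x
  by_cases hx : x ∈ Iic (0 : ℝ) <;>
    simp only [energyDensity, Set.piecewise, hx, if_true, if_false]

theorem momentumDensity_piecewise (ρ w ρ' w' : ℝ → ℝ) :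
    momentumDensity ((Iic (0 : ℝ)).piecewise ρ ρ') ((Iic (0 : ℝ)).piecewise w w') =
    (Iic (0 : ℝ)).piecewise (momentumDensity ρ w) (momentumDensity ρ' w') := by
  ext x
  by_cases hx : x ∈ Iic (0 : ℝ) <;>
    simp only [momentumDensity, Set.piecewise, hx, if_true, if_false]

/-- `(e, p)` is the energy and the momentum on the left half-line of some hydrodynamic data whose
modulus at the origin is `b`. -/
def HalfAttained (f : ℝ → ℝ) (b e p : ℝ) : Prop :=
  ∃ ρ σ w : ℝ → ℝ, IsHydro f ρ σ w ∧ ρ 0 = b ∧ ∫ x in Iic 0, energyDensity f ρ σ w x = e ∧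
    ∫ x in Iic 0, momentumDensity ρ w x = p

theorem IsHydro.integral_piecewise {ρ' σ' w' : ℝ → ℝ} (hf : Admissible f) (h : IsHydro f ρ σ w)
    (h' : IsHydro f ρ' σ' w') :
    (∫ x, energyDensity f ((Iic (0 : ℝ)).piecewise ρ ρ') ((Iic (0 : ℝ)).piecewise σ σ')
        ((Iic (0 : ℝ)).piecewise w w') x =
      (∫ x in Iic 0, energyDensity f ρ σ w x) + ∫ x in Ioi 0, energyDensity f ρ' σ' w' x) ∧
    ∫ x, momentumDensity ((Iic (0 : ℝ)).piecewise ρ ρ') ((Iic (0 : ℝ)).piecewise w w') x =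
      (∫ x in Iic 0, momentumDensity ρ w x) + ∫ x in Ioi 0, momentumDensity ρ' w' x := by
  rw [energyDensity_piecewise, momentumDensity_piecewise,
    MeasureTheory.integral_piecewise measurableSet_Iic h.integrable_energyDensity.integrableOn
      h'.integrable_energyDensity.integrableOn,
    MeasureTheory.integral_piecewise measurableSet_Iic
      (h.integrable_momentumDensity hf).integrableOn
      (h'.integrable_momentumDensity hf).integrableOn, compl_Iic]
  exact ⟨rfl, rfl⟩

/-- The second half is moved to the right half-line by `x ↦ -x` combined with complex conjugation,
which keeps the sign of `w` and so the momentum. -/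
theorem HalfAttained.join (hf : Admissible f) {b e p e' p' : ℝ} (h : HalfAttained f b e p)
    (h' : HalfAttained f b e' p') : Attained f (e + e') (p + p') := by
  obtain ⟨ρ, σ, w, h, h0, rfl, rfl⟩ := h
  obtain ⟨ρ', σ', w', h', h0', rfl, rfl⟩ := h'
  have hi := h.integral_piecewise hf h'.comp_neg
  refine ⟨_, _, _, h.piecewise h'.comp_neg (by simp [h0, h0']), hi.1.trans ?_, hi.2.trans ?_⟩
  · congr 1
    have := integral_comp_neg_Ioi 0 (energyDensity f ρ' σ' w')
    rw [neg_zero] at this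
    rw [← this]
    simp only [energyDensity, neg_sq]
  · congr 1
    have := integral_comp_neg_Ioi 0 (momentumDensity ρ' w')
    rw [neg_zero] at this
    rw [← this]
    rfl

theorem setIntegral_Iic_comp_add_right (g : ℝ → ℝ) (a : ℝ) :
    ∫ x in Iic 0, g (x + a) = ∫ x in Iic a, g x := by
  have := (measurePreserving_add_right volume a).setIntegral_preimage_emb
    (measurableEmbedding_addRight a) g (Iic a)
  simpa using this

theorem IsHydro.halfAttained_left (h : IsHydro f ρ σ w) (a : ℝ) :
    HalfAttained f (ρ a) (∫ x in Iic a, energyDensity f ρ σ w x)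
      (∫ x in Iic a, momentumDensity ρ w x) :=
  ⟨_, _, _, h.comp_add_right a, by simp,
    setIntegral_Iic_comp_add_right (energyDensity f ρ σ w) a,
    setIntegral_Iic_comp_add_right (momentumDensity ρ w) a⟩

theorem IsHydro.halfAttained_right (h : IsHydro f ρ σ w) (a : ℝ) :
    HalfAttained f (ρ a) (∫ x in Ioi a, energyDensity f ρ σ w x)
      (∫ x in Ioi a, momentumDensity ρ w x) := by
  have h1 := h.comp_neg.halfAttained_left (-a)
  have h2 := integral_comp_neg_Iic (-a) (energyDensity f ρ σ w)
  have h3 := integral_comp_neg_Iic (-a) (momentumDensity ρ w)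
  rw [neg_neg] at h2 h3
  rw [← h2, ← h3]
  simpa only [energyDensity, momentumDensity, neg_sq, neg_neg] using h1

/-- Reflecting data about a point. -/
theorem Attained.reflect (hf : Admissible f) {e p s : ℝ} (h : Attained f e p) (hs : 0 < s)
    (hs' : s < 2 * p) :
    ∃ e₁ e₂, Attained f e₁ s ∧ Attained f e₂ (2 * p - s) ∧ e₁ + e₂ = 2 * e := by
  obtain ⟨ρ, σ, w, h, rfl, rfl⟩ := h
  set m := momentumDensity ρ w with hm
  have hmi : Integrable m := h.integrable_momentumDensity hf
  have hei := h.integrable_energyDensity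
  set G : ℝ → ℝ := fun a => ∫ x in Iic a, m x with hG
  have hGc : Continuous G := by
    have : G = fun a => G 0 + ∫ x in (0 : ℝ)..a, m x := by
      ext a
      rw [← intervalIntegral.integral_Iic_sub_Iic hmi.integrableOn hmi.integrableOn]
      simp [hG]
    rw [this]
    exact continuous_const.add (intervalIntegral.continuous_primitive
      (fun a b => hmi.intervalIntegrable) 0)
  have hsplit : ∀ a, G a + ∫ x in Ioi a, m x = ∫ x, m x := fun a =>
    intervalIntegral.integral_Iic_add_Ioi hmi.integrableOn hmi.integrableOn
  have htop : Tendsto G atTop (𝓝 (∫ x, m x)) :=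
    (aecover_Iic tendsto_id).integral_tendsto_of_countably_generated hmi
  have hbot : Tendsto (fun a => ∫ x in Ioi a, m x) atBot (𝓝 (∫ x, m x)) :=
    (aecover_Ioi tendsto_id).integral_tendsto_of_countably_generated hmi
  -- `G` runs continuously from zero to the total momentum, and `s / 2` lies strictly between; the
  -- value at the left end is read off from the complementary half-line.
  have h1 : ∃ a, G a ≤ s / 2 := by
    obtain ⟨a, ha⟩ := (hbot.eventually (lt_mem_nhds
      (show (∫ x, m x) - s / 2 < ∫ x, m x by linarith))).exists
    exact ⟨a, by linarith [hsplit a]⟩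
  have h2 : ∃ a, s / 2 ≤ G a := by
    obtain ⟨a, ha⟩ := (htop.eventually (lt_mem_nhds
      (show s / 2 < ∫ x, m x by linarith))).exists
    exact ⟨a, ha.le⟩
  obtain ⟨a, ha⟩ := mem_range_of_exists_le_of_exists_ge hGc h1 h2
  have hl := h.halfAttained_left a
  have hr := h.halfAttained_right a
  refine ⟨2 * ∫ x in Iic a, energyDensity f ρ σ w x, 2 * ∫ x in Ioi a, energyDensity f ρ σ w x,
    ?_, ?_, ?_⟩
  · convert hl.join hf hl using 1
    · ring
    · rw [← hm]; change G a = s / 2 at ha; change s = G a + G a; rw [ha]; ring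
  · convert hr.join hf hr using 1
    · ring
    · have := hsplit a
      rw [← hm]; linarith
  · rw [← mul_add, intervalIntegral.integral_Iic_add_Ioi hei.integrableOn hei.integrableOn]

/-- Otherwise `{ε ≤ g}` would contain a half-line and have infinite measure. This replaces decay at
infinity. -/
theorem exists_ge_lt_of_integrable {g : ℝ → ℝ} (hg : Integrable g) {ε : ℝ} (hε : 0 < ε) (N : ℝ) :
    ∃ R ≥ N, g R < ε := by
  by_contra! hcon
  have h1 := hg.measure_ge_lt_top hε
  have h2 : volume (Ici N) ≤ volume {a | ε ≤ g a} := measure_mono fun x hx => hcon x hx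
  rw [Real.volume_Ici] at h2
  exact absurd h1 (by simpa using h2)

/-- A compactly supported bump which joins moduli close to one to the constant one. -/
theorem exists_tent :
    ∃ k k' : ℝ → ℝ, (∀ x, HasDerivAt k (k' x) x) ∧ Continuous k' ∧ k 0 = 1 ∧
      (∀ x, 0 ≤ k x ∧ k x ≤ 1) ∧ (∀ x, 2 ≤ |x| → k x = 0 ∧ k' x = 0) ∧
      ∃ C, ∀ x, |k' x| ≤ C := by
  let χ : ContDiffBump (0 : ℝ) := ⟨1, 2, one_pos, one_lt_two⟩
  have h1 : ContDiff ℝ ∞ χ := χ.contDiff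
  have hc : Continuous (deriv χ) := h1.continuous_deriv (by simp)
  have h0 : ∀ x, 2 ≤ |x| → χ x = 0 := fun x hx => χ.zero_of_le_dist (by simpa using hx)
  have hn : ∀ x, 0 ≤ χ x := fun x => χ.nonneg
  refine ⟨χ, deriv χ, fun x => (h1.differentiable (by simp) x).hasDerivAt, hc,
    χ.one_of_mem_closedBall (by simp [χ]), fun x => ⟨χ.nonneg, χ.le_one⟩, fun x hx => ⟨h0 x hx, ?_⟩,
    χ.hasCompactSupport.deriv.exists_bound_of_continuous hc⟩
  -- The bump attains its minimum zero at such `x`, so its derivative vanishes even at the boundary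
  -- `|x| = 2`.
  refine IsLocalMin.deriv_eq_zero (Eventually.of_forall fun y => ?_)
  rw [h0 x hx]; exact hn y

/-- A transition from modulus `b` to modulus one with no momentum, whose cost tends to zero as `b →
1`. -/
theorem isHydro_tent (hf : Admissible f) {ε : ℝ} (hε : 0 < ε) :
    ∃ δ > 0, ∀ b, |b - 1| < δ → ∃ ρ σ : ℝ → ℝ, IsHydro f ρ σ (fun _ => 0) ∧ ρ 0 = b ∧ ρ 2 = 1 ∧
      ∫ x, energyDensity f ρ σ (fun _ => 0) x ≤ ε := by
  obtain ⟨k, k', hd, hk', hk0, hk01, hkz, C, hC⟩ := exists_tent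
  have hF : Tendsto (fun s => F f (s ^ 2)) (𝓝 1) (𝓝 0) := by
    have : Continuous fun s => F f (s ^ 2) := hf.continuous_F.comp (continuous_pow 2)
    simpa using this.tendsto 1
  obtain ⟨δ₁, hδ₁, h1⟩ := Metric.eventually_nhds_iff.mp
    (hF.eventually (gt_mem_nhds (show (0 : ℝ) < ε / 4 by positivity)))
  have hS : Tendsto (fun t : ℝ => (t * C) ^ 2) (𝓝 0) (𝓝 0) := by
    have : Continuous fun t : ℝ => (t * C) ^ 2 := by fun_prop
    simpa using this.tendsto 0
  obtain ⟨δ₂, hδ₂, h2⟩ := Metric.eventually_nhds_iff.mp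
    (hS.eventually (gt_mem_nhds (show (0 : ℝ) < ε / 4 by positivity)))
  -- `1 / 2` keeps the modulus positive, `δ₁` controls the potential and `δ₂` the gradient. The
  -- density is then at most `ε / 4` on an interval of length four.
  refine ⟨min (1 / 2) (min δ₁ δ₂), by positivity, fun b hb => ?_⟩
  obtain ⟨hb0, hb⟩ := lt_min_iff.mp hb
  obtain ⟨hb1, hb2⟩ := lt_min_iff.mp hb
  set ρ : ℝ → ℝ := fun x => 1 + (b - 1) * k x with hρ
  set σ : ℝ → ℝ := fun x => (b - 1) * k' x with hσ
  have hρp : IsPrimitive ρ σ :=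
    IsPrimitive.of_hasDerivAt (fun x => ((hd x).const_mul _).const_add _) (hk'.const_mul _)
  have hρ1 : ∀ x, |ρ x - 1| ≤ |b - 1| := fun x => by
    simp only [hρ, add_sub_cancel_left, abs_mul]
    rw [abs_of_nonneg (hk01 x).1]
    exact mul_le_of_le_one_right (abs_nonneg _) (hk01 x).2
  have hρz : ∀ x, 2 ≤ |x| → ρ x = 1 ∧ σ x = 0 := fun x hx => by simp [hρ, hσ, hkz x hx]
  have hsupp : ∀ g : ℝ → ℝ, Continuous g → (∀ x, 2 ≤ |x| → g x = 0) → HasCompactSupport g :=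
    fun g _ h => HasCompactSupport.intro (isCompact_Icc (a := (-2 : ℝ)) (b := 2)) fun x hx => by
      apply h
      by_contra h3
      push Not at h3
      have := abs_lt.mp h3
      exact hx ⟨this.1.le, this.2.le⟩
  have hσc : Continuous σ := hk'.const_mul _
  have hFc : Continuous fun x => F f (ρ x ^ 2) := hf.continuous_F.comp (hρp.continuous.pow 2)
  have hy : IsHydro f ρ σ (fun _ => 0) := by
    refine ⟨hρp, hσc.memLp_of_hasCompactSupport (hsupp σ hσc fun x hx => (hρz x hx).2), by simp,
      ⟨1 / 2, by norm_num, fun x => ?_⟩,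
      hFc.integrable_of_hasCompactSupport (hsupp _ hFc fun x hx => by simp [(hρz x hx).1])⟩
    have := abs_le.mp ((hρ1 x).trans hb0.le)
    linarith [this.1]
  refine ⟨ρ, σ, hy, by simp [hρ, hk0], (hρz 2 (by norm_num)).1, ?_⟩
  have hs : Function.support (energyDensity f ρ σ fun _ => 0) ⊆ Ioc (-2) 2 := by
    intro x hx
    by_contra hx'
    have h3 : 2 ≤ |x| := by
      by_contra h3
      push Not at h3
      have := abs_lt.mp h3
      exact hx' ⟨this.1, this.2.le⟩
    apply hx
    simp [energyDensity, hρz x h3]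
  rw [← intervalIntegral.integral_eq_integral_of_support_subset hs]
  have hle : ∀ x ∈ Icc (-2 : ℝ) 2, energyDensity f ρ σ (fun _ => 0) x ≤ ε / 4 := fun x _ => by
    have e1 : F f (ρ x ^ 2) < ε / 4 := h1 (by rw [Real.dist_eq]; exact (hρ1 x).trans_lt hb1)
    have e2 : ((b - 1) * C) ^ 2 < ε / 4 := h2 (by rw [Real.dist_eq, sub_zero]; exact hb2)
    have e3 : σ x ^ 2 ≤ ((b - 1) * C) ^ 2 := by
      simp only [hσ, mul_pow]
      refine mul_le_mul_of_nonneg_left ?_ (sq_nonneg _)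
      rw [← sq_abs]
      exact pow_le_pow_left₀ (abs_nonneg _) (hC x) 2
    simp only [energyDensity, mul_zero]
    linarith
  have := intervalIntegral.integral_mono_on (by norm_num)
      hy.integrable_energyDensity.intervalIntegrable
    (intervalIntegrable_const (c := ε / 4) (μ := volume)) hle
  refine this.trans (le_of_eq ?_)
  rw [intervalIntegral.integral_const]
  norm_num
  ring

/-- Data can be cut off at infinity with little change of energy and momentum. -/
theorem Attained.halfAttained_one (hf : Admissible f) {e p ε : ℝ} (h : Attained f e p)
    (hε : 0 < ε) : ∃ e' p', HalfAttained f 1 e' p' ∧ e' ≤ e + ε ∧ |p' - p| ≤ ε := by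
  obtain ⟨ρ, σ, w, h, rfl, rfl⟩ := h
  obtain ⟨δ, hδ, htent⟩ := isHydro_tent hf hε
  have hmi := h.integrable_momentumDensity hf
  have hei := h.integrable_energyDensity
  have htop := (aecover_Iic tendsto_id).integral_tendsto_of_countably_generated hmi
  obtain ⟨N, hN⟩ := eventually_atTop.mp
    (Metric.tendsto_nhds.mp htop ε hε)
  -- Beyond `N` little momentum is left, and at `R` the modulus is close enough to one for a cheap
  -- transition. The transition carries no momentum.
  obtain ⟨R, hR, hRδ⟩ := exists_ge_lt_of_integrable (h.integrable_eta_sq hf)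
    (show 0 < δ ^ 2 by positivity) N
  have hb : |ρ R - 1| < δ := by
    have h1 := abs_lt_of_sq_lt_sq hRδ hδ.le
    have h2 : |1 - ρ R ^ 2| = |ρ R - 1| * (1 + ρ R) := by
      rw [← abs_of_pos (show 0 < 1 + ρ R by linarith [h.rho_pos R]), ← abs_mul, ← abs_neg]
      congr 1; ring
    have h3 : |ρ R - 1| ≤ |ρ R - 1| * (1 + ρ R) :=
      le_mul_of_one_le_right (abs_nonneg _) (by linarith [h.rho_pos R])
    linarith
  obtain ⟨ρ', σ', h', h0', h2', he'⟩ := htent (ρ R) hb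
  have hR' := h.comp_add_right R
  have hcat := hR'.piecewise h' (by simp [h0'])
  have hi := hR'.integral_piecewise hf h'
  have hhalf := hcat.halfAttained_left 2
  have hb2 : (Iic (0 : ℝ)).piecewise (fun x => ρ (x + R)) ρ' 2 = 1 := by
    rw [Set.piecewise_eq_of_notMem _ _ _ (by simp), h2']
  rw [hb2] at hhalf
  refine ⟨_, _, hhalf, ?_, ?_⟩
  · refine (setIntegral_le_integral hcat.integrable_energyDensity
      (Eventually.of_forall fun x => energyDensity_nonneg hf _ _ _ x)).trans ?_
    rw [hi.1]
    refine add_le_add ?_ ?_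
    · refine (setIntegral_Iic_comp_add_right (energyDensity f ρ σ w) R).le.trans ?_
      exact setIntegral_le_integral hei
          (Eventually.of_forall fun x => energyDensity_nonneg hf _ _ _ x)
    · refine le_trans ?_ he'
      exact setIntegral_le_integral h'.integrable_energyDensity
        (Eventually.of_forall fun x => energyDensity_nonneg hf _ _ _ x)
  · have : ∫ x in Iic 2, momentumDensity ((Iic (0 : ℝ)).piecewise (fun x => ρ (x + R)) ρ')
        ((Iic (0 : ℝ)).piecewise (fun x => w (x + R)) fun _ => 0) x =
        ∫ x in Iic R, momentumDensity ρ w x := by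
      rw [momentumDensity_piecewise, ← setIntegral_Iic_comp_add_right (momentumDensity ρ w) R]
      have h3 : momentumDensity ρ' (fun _ => 0) = 0 := by ext x; simp [momentumDensity]
      rw [h3, Set.piecewise_eq_indicator, setIntegral_indicator measurableSet_Iic,
        Iic_inter_Iic, min_eq_right (by norm_num)]
      rfl
    rw [this]
    exact (hN R hR).le

/-- Scaling `w` alone scales the momentum linearly and only the phase part of the energy, by `t²`.
-/
theorem Attained.mul_momentum (hf : Admissible f) {e p : ℝ} (h : Attained f e p) (t : ℝ) :
    ∃ e', Attained f e' (t * p) ∧ e' ≤ max 1 (t ^ 2) * e := by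
  obtain ⟨ρ, σ, w, h, rfl, rfl⟩ := h
  refine ⟨_, ⟨_, _, _, h.mul_velocity t, rfl, ?_⟩, ?_⟩
  · rw [← integral_const_mul]
    congr 1; ext x; simp only [momentumDensity]; ring
  · rw [← integral_const_mul]
    refine integral_mono (h.mul_velocity t).integrable_energyDensity
      (h.integrable_energyDensity.const_mul _) fun x => ?_
    have hF := hf.F_nonneg (sq_nonneg (ρ x))
    have h1 := mul_le_mul_of_nonneg_right (le_max_left 1 (t ^ 2)) (sq_nonneg (σ x))
    have h2 := mul_le_mul_of_nonneg_right (le_max_right 1 (t ^ 2)) (sq_nonneg (ρ x * w x))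
    have h3 := mul_le_mul_of_nonneg_right (le_max_left 1 (t ^ 2)) hF
    simp only [energyDensity]
    rw [show ρ x * (t * w x) = t * (ρ x * w x) by ring, mul_pow]
    linarith

theorem Attained.nonneg (hf : Admissible f) {e p : ℝ} (h : Attained f e p) : 0 ≤ e := by
  obtain ⟨ρ, σ, w, h, rfl, rfl⟩ := h
  exact integral_nonneg fun x => energyDensity_nonneg hf _ _ _ x

theorem Attained.neg {e p : ℝ} (h : Attained f e p) : Attained f e (-p) := by
  obtain ⟨ρ, σ, w, h, rfl, rfl⟩ := h
  refine ⟨_, _, _, h.mul_velocity (-1), ?_, ?_⟩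
  · congr 1; ext x; simp only [energyDensity]; ring
  · rw [← integral_neg]
    congr 1; ext x; simp only [momentumDensity]; ring

theorem attained_zero (f : ℝ → ℝ) : Attained f 0 0 := by
  refine ⟨fun _ => 1, fun _ => 0, fun _ => 0,
    ⟨⟨locallyIntegrable_zero, by simp⟩, by simp, by simp, ⟨1, one_pos, fun _ => le_rfl⟩, by simp⟩,
    by simp [energyDensity], by simp [momentumDensity]⟩

/-- Both data are cut off at modulus one and joined, and the small momentum error is repaired by
scaling the velocity. The factor is close to one because `p + p' ≠ 0`. -/
theorem Attained.add (hf : Admissible f) {e p e' p' ε : ℝ} (h : Attained f e p)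
    (h' : Attained f e' p') (hp : p + p' ≠ 0) (hε : 0 < ε) :
    ∃ e'' ≤ e + e' + ε, Attained f e'' (p + p') := by
  set s := |p + p'| with hs
  have hs0 : 0 < s := abs_pos.mpr hp
  have hlim : Tendsto (fun δ : ℝ => (s / (s - 2 * δ)) ^ 2 * (e + e' + 2 * δ)) (𝓝 0)
      (𝓝 (e + e')) := by
    have hc : ContinuousAt (fun δ : ℝ => (s / (s - 2 * δ)) ^ 2 * (e + e' + 2 * δ)) 0 := by
      refine ContinuousAt.mul (ContinuousAt.pow (ContinuousAt.div (by fun_prop) (by fun_prop)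
        (by simpa using hs0.ne')) 2) (by fun_prop)
    have := hc.tendsto
    simpa [div_self hs0.ne'] using this
  have hev := (hlim.eventually (gt_mem_nhds (show e + e' < e + e' + ε by linarith))).and
    (gt_mem_nhds (show (0 : ℝ) < s / 2 by positivity))
  obtain ⟨δ, ⟨hδ1, hδ2⟩, hδ0 : 0 < δ⟩ :=
    ((hev.filter_mono nhdsWithin_le_nhds).and (self_mem_nhdsWithin (s := Ioi (0 : ℝ)))).exists
  obtain ⟨e₁, p₁, h1, he1, hp1⟩ := h.halfAttained_one hf hδ0
  obtain ⟨e₂, p₂, h2, he2, hp2⟩ := h'.halfAttained_one hf hδ0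
  have hj := h1.join hf h2
  have habs : |p₁ + p₂ - (p + p')| ≤ 2 * δ := by
    have := abs_add_le (p₁ - p) (p₂ - p')
    rw [show p₁ - p + (p₂ - p') = p₁ + p₂ - (p + p') by ring] at this
    linarith
  have hlow : s - 2 * δ ≤ |p₁ + p₂| := by
    have := abs_sub_abs_le_abs_sub (p + p') (p₁ + p₂)
    rw [abs_sub_comm] at this
    linarith
  have hpos : 0 < s - 2 * δ := by linarith
  have hne : p₁ + p₂ ≠ 0 := abs_pos.mp (hpos.trans_le hlow)
  obtain ⟨e'', hA, hle⟩ := hj.mul_momentum hf ((p + p') / (p₁ + p₂))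
  rw [div_mul_cancel₀ _ hne] at hA
  refine ⟨e'', hle.trans (le_trans ?_ hδ1.le), hA⟩
  have hmax : max 1 (((p + p') / (p₁ + p₂)) ^ 2) ≤ (s / (s - 2 * δ)) ^ 2 := by
    refine max_le ?_ ?_
    · refine one_le_pow₀ ?_
      rw [le_div_iff₀ hpos]; linarith
    · rw [← sq_abs, abs_div, ← hs]
      exact pow_le_pow_left₀ (by positivity) (by gcongr) 2
  refine mul_le_mul hmax (by linarith) (hj.nonneg hf) (by positivity)

end Operations

/-! ### Long-wave trial data and the upper bound -/

section Trial

open Set Filter Topology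

variable {f : ℝ → ℝ}

theorem Admissible.contDiff_F (hf : Admissible f) : ContDiff ℝ 4 (F f) := by
  have hd : deriv (F f) = -f := funext fun x => (hf.hasDerivAt_F x).deriv
  rw [show (4 : WithTop ℕ∞) = 3 + 1 by norm_num, contDiff_succ_iff_deriv, hd]
  exact ⟨fun x => (hf.hasDerivAt_F x).differentiableAt, by simp, hf.contDiff.neg⟩

/-- The potential agrees with its quadratic part up to a quartic error: the lower bound on `F`
forces the cubic term to vanish. -/
theorem Admissible.F_le (hf : Admissible f) :
    ∃ C > 0, ∃ δ > 0, ∀ y, |y| < δ →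
      F f (1 + y) ≤ soundSpeed f ^ 2 / 4 * y ^ 2 + C * y ^ 4 := by
  have hd : deriv (F f) = -f := funext fun x => (hf.hasDerivAt_F x).deriv
  obtain ⟨A, hA⟩ : ∃ A, iteratedDeriv 4 (F f) 1 = A := ⟨_, rfl⟩
  obtain ⟨B, hB⟩ : ∃ B, deriv (deriv f) 1 = B := ⟨_, rfl⟩
  have hd2 : deriv (-f) = -deriv f := funext fun x => deriv.neg
  have hd3 : deriv (-deriv f) = -deriv (deriv f) := funext fun x => deriv.neg
  have h1 : iteratedDeriv 1 (F f) 1 = 0 := by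
    rw [iteratedDeriv_one, hd, Pi.neg_apply, hf.map_one, neg_zero]
  have h2 : iteratedDeriv 2 (F f) 1 = soundSpeed f ^ 2 / 2 := by
    rw [iteratedDeriv_succ', iteratedDeriv_one, hd, hd2, Pi.neg_apply, hf.soundSpeed_sq]; ring
  have h3 : iteratedDeriv 3 (F f) 1 = -B := by
    rw [iteratedDeriv_succ', iteratedDeriv_succ', iteratedDeriv_one, hd, hd2, hd3, Pi.neg_apply, hB]
  have hT := taylor_isLittleO_univ (x₀ := 1) (n := 4) hf.contDiff_F
  obtain ⟨δ, hδ, hb⟩ := Metric.eventually_nhds_iff.mp (hT.bound one_pos)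
  have key : ∀ y, |y| < δ →
      |F f (1 + y) - (soundSpeed f ^ 2 / 4 * y ^ 2 - B / 6 * y ^ 3 + A / 24 * y ^ 4)| ≤ y ^ 4 := by
    intro y hy
    have := hb (y := 1 + y) (by simpa using hy)
    simp only [taylor_within_apply, Finset.sum_range_succ, Finset.sum_range_zero,
      iteratedDerivWithin_univ, h1, h2, h3, hA, iteratedDeriv_zero, F_one, add_sub_cancel_left,
      Real.norm_eq_abs, smul_eq_mul, Nat.factorial, one_mul] at this
    rw [abs_of_nonneg (show (0 : ℝ) ≤ y ^ 4 by positivity)] at this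
    convert this using 2
    push_cast
    ring
  set D := |A / 24| + 1 with hD
  have hDpos : 0 < D := by positivity
  have hle : ∀ y, |y| < δ →
      F f (1 + y) ≤ soundSpeed f ^ 2 / 4 * y ^ 2 - B / 6 * y ^ 3 + D * y ^ 4 := by
    intro y hy
    have h4 := (abs_le.mp (key y hy)).2
    have h5 : A / 24 * y ^ 4 ≤ |A / 24| * y ^ 4 :=
      mul_le_mul_of_nonneg_right (le_abs_self _) (by positivity)
    rw [hD]; linarith
  have hcub : ∀ y, |y| < δ → |y| < 1 → 0 ≤ -(B / 6) * y ^ 3 + D * y ^ 4 := by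
    intro y hy hy1
    have := hf.lower (1 + y) (by linarith [(abs_lt.mp hy1).1])
    rw [show 1 - (1 + y) = -y by ring, neg_sq] at this
    linarith [hle y hy]
  have hB0 : B = 0 := by
    by_contra hne
    -- Testing at `y = ±s` gives `|B| ≤ 6 D s`, which the last entry turns into `|B| ≤ |B| / 2`.
    set s := min (δ / 2) (min (1 / 2) (|B| / (12 * D))) with hs
    have hspos : 0 < s := by positivity
    have hs1 : s < δ := (min_le_left _ _).trans_lt (by linarith)
    have hs2 : s < 1 := ((min_le_right _ _).trans (min_le_left _ _)).trans_lt (by norm_num)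
    have hs3 : s * (12 * D) ≤ |B| := by
      rw [← le_div_iff₀ (by positivity)]
      exact (min_le_right _ _).trans (min_le_right _ _)
    have h6 : 0 ≤ s ^ 3 * (-(B / 6) + D * s) := by
      have := hcub s (by rwa [abs_of_pos hspos]) (by rwa [abs_of_pos hspos])
      linarith
    have h7 : 0 ≤ s ^ 3 * (B / 6 + D * s) := by
      have := hcub (-s) (by rwa [abs_neg, abs_of_pos hspos]) (by rwa [abs_neg, abs_of_pos hspos])
      linarith [show -(B / 6) * (-s) ^ 3 + D * (-s) ^ 4 = s ^ 3 * (B / 6 + D * s) by ring]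
    have h8 := nonneg_of_mul_nonneg_right h6 (by positivity)
    have h9 := nonneg_of_mul_nonneg_right h7 (by positivity)
    have h10 : |B| ≤ 6 * (D * s) := abs_le.mpr ⟨by linarith, by linarith⟩
    have h11 : 0 < |B| := abs_pos.mpr hne
    nlinarith
  refine ⟨D, hDpos, δ, hδ, fun y hy => ?_⟩
  have := hle y hy
  rw [hB0] at this
  linarith

/-- The Lorentzian profile used in trial functions. -/
noncomputable def lorentz (x : ℝ) : ℝ := (1 + x ^ 2)⁻¹

theorem lorentz_pos (x : ℝ) : 0 < lorentz x := by unfold lorentz; positivity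

theorem lorentz_le_one (x : ℝ) : lorentz x ≤ 1 :=
  inv_le_one_of_one_le₀ (by nlinarith [sq_nonneg x])

theorem continuous_lorentz : Continuous lorentz :=
  Continuous.inv₀ (by fun_prop) fun x => by positivity

theorem integrable_lorentz : Integrable lorentz := integrable_inv_one_add_sq

theorem integrable_lorentz_pow (n : ℕ) (hn : 1 ≤ n) : Integrable fun x => lorentz x ^ n := by
  refine integrable_lorentz.mono' (continuous_lorentz.pow n).aestronglyMeasurable
    (Eventually.of_forall fun x => ?_)
  rw [Real.norm_of_nonneg (pow_nonneg (lorentz_pos x).le n)]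
  exact pow_le_of_le_one (lorentz_pos x).le (lorentz_le_one x) (by omega)

theorem integral_lorentz_pow_pos (n : ℕ) (hn : 1 ≤ n) : 0 < ∫ x, lorentz x ^ n := by
  rw [integral_pos_iff_support_of_nonneg (fun x => pow_nonneg (lorentz_pos x).le n)
    (integrable_lorentz_pow n hn)]
  have : Function.support (fun x => lorentz x ^ n) = univ :=
    eq_univ_of_forall fun x => (pow_pos (lorentz_pos x) n).ne'
  simp [this]

theorem hasDerivAt_lorentz (x : ℝ) : HasDerivAt lorentz (-(2 * x) * lorentz x ^ 2) x := by
  have h := ((hasDerivAt_pow 2 x).const_add 1).inv (show 1 + x ^ 2 ≠ 0 by positivity)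
  refine h.congr_deriv ?_
  unfold lorentz
  have : 1 + x ^ 2 ≠ 0 := by positivity
  field_simp
  ring

/-- From `2|x| ≤ 1 + x²`; the gradient energy is thereby measured by the same integral as the other
quadratic terms. -/
theorem deriv_lorentz_sq_le (x : ℝ) : (-(2 * x) * lorentz x ^ 2) ^ 2 ≤ lorentz x ^ 2 := by
  have h1 : lorentz x * (1 + x ^ 2) = 1 := inv_mul_cancel₀ (by positivity)
  have h2 : (2 * x) ^ 2 ≤ (1 + x ^ 2) ^ 2 := by nlinarith [sq_nonneg (1 - x ^ 2)]
  calc (-(2 * x) * lorentz x ^ 2) ^ 2 = (2 * x) ^ 2 * lorentz x ^ 4 := by ring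
    _ ≤ (1 + x ^ 2) ^ 2 * lorentz x ^ 4 := by
      exact mul_le_mul_of_nonneg_right h2 (pow_nonneg (lorentz_pos x).le 4)
    _ = (lorentz x * (1 + x ^ 2)) ^ 2 * lorentz x ^ 2 := by ring
    _ = lorentz x ^ 2 := by rw [h1]; ring

/-- Trial data of amplitude `a` and width `b⁻¹`. -/
theorem attained_trial (hf : Admissible f) {C δ a b : ℝ} (hC : 0 < C)
    (hF : ∀ y, |y| < δ → F f (1 + y) ≤ soundSpeed f ^ 2 / 4 * y ^ 2 + C * y ^ 4)
    (ha : 0 < a) (ha' : a ≤ 1 / 2) (haδ : a < δ) (hb : 0 < b) :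
    ∃ e, Attained f e (soundSpeed f / 4 * a ^ 2 * ((∫ x, lorentz x ^ 2) / b)) ∧
      e ≤ ((a ^ 2 * b ^ 2 / 2 + soundSpeed f ^ 2 / 2 * a ^ 2) * ((∫ x, lorentz x ^ 2) / b) -
        (soundSpeed f ^ 2 / 4 * a ^ 3 - C * a ^ 4) * ((∫ x, lorentz x ^ 3) / b)) / 2 := by
  set c := soundSpeed f with hc
  set k : ℝ → ℝ := fun x => lorentz (b * x) with hk
  have hk0 : ∀ x, 0 < k x := fun x => lorentz_pos _
  have hk1 : ∀ x, k x ≤ 1 := fun x => lorentz_le_one _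
  have hkc : Continuous k := continuous_lorentz.comp (continuous_const_mul b)
  set k' : ℝ → ℝ := fun x => b * (-(2 * (b * x)) * lorentz (b * x) ^ 2) with hk'
  have hkd : ∀ x, HasDerivAt k (k' x) x := fun x => by
    have := (hasDerivAt_lorentz (b * x)).comp x ((hasDerivAt_id x).const_mul b)
    refine this.congr_deriv ?_
    simp only [hk']; ring
  have hk'c : Continuous k' := by
    have := continuous_lorentz
    simp only [hk']; fun_prop
  have hk'le : ∀ x, k' x ^ 2 ≤ b ^ 2 * k x ^ 2 := fun x => by
    simp only [hk', hk, mul_pow b]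
    exact mul_le_mul_of_nonneg_left (deriv_lorentz_sq_le _) (sq_nonneg b)
  have hki : ∀ n : ℕ, 1 ≤ n → Integrable fun x => k x ^ n := fun n hn =>
    (integrable_lorentz_pow n hn).comp_mul_left' hb.ne'
  have hkI : ∀ n : ℕ, ∫ x, k x ^ n = (∫ x, lorentz x ^ n) / b := fun n => by
    simp only [hk]
    rw [Measure.integral_comp_mul_left (fun x => lorentz x ^ n) b, abs_of_pos (inv_pos.mpr hb),
      smul_eq_mul, inv_mul_eq_div]
  have hη : ∀ x, 0 < a * k x ∧ a * k x ≤ a := fun x =>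
    ⟨mul_pos ha (hk0 x), mul_le_of_le_one_right ha.le (hk1 x)⟩
  have hr : ∀ x, 1 / 2 ≤ 1 - a * k x := fun x => by linarith [(hη x).2]
  set ρ : ℝ → ℝ := fun x => Real.sqrt (1 - a * k x) with hρ
  have hρsq : ∀ x, ρ x ^ 2 = 1 - a * k x := fun x => Real.sq_sqrt (by linarith [hr x])
  have hρlow : ∀ x, 1 / 2 ≤ ρ x := fun x => by
    refine Real.le_sqrt_of_sq_le ?_
    linarith [hr x]
  have hρ0 : ∀ x, 0 < ρ x := fun x => by linarith [hρlow x]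
  have hρc : Continuous ρ := Real.continuous_sqrt.comp (by fun_prop)
  set σ : ℝ → ℝ := fun x => -(a * k' x) / (2 * ρ x) with hσ
  have hσc : Continuous σ := by
    refine Continuous.div (by fun_prop) (by fun_prop) fun x => ?_
    have := hρ0 x; positivity
  have hρp : IsPrimitive ρ σ := by
    refine IsPrimitive.of_hasDerivAt (fun x => ?_) hσc
    exact (((hkd x).const_mul a).const_sub 1).sqrt (by linarith [hr x])
  have hσle : ∀ x, σ x ^ 2 ≤ a ^ 2 * b ^ 2 / 2 * k x ^ 2 := fun x => by
    have e : σ x ^ 2 = a ^ 2 * k' x ^ 2 / (4 * ρ x ^ 2) := by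
      simp only [hσ]; ring
    rw [e, hρsq, div_le_iff₀ (by linarith [hr x])]
    have h1 := mul_le_mul_of_nonneg_left (hk'le x) (sq_nonneg a)
    have h2 : 0 ≤ a ^ 2 * b ^ 2 * k x ^ 2 := by positivity
    nlinarith [hr x]
  -- The sonic choice `w = c η / 2`: at leading order the energy density is `c² η² / 4`, exactly `c`
  -- times the momentum density.
  set w : ℝ → ℝ := fun x => c / 2 * (a * k x) with hw
  have hwc : Continuous w := by fun_prop
  have hFle : ∀ x, F f (ρ x ^ 2) ≤ c ^ 2 / 4 * a ^ 2 * k x ^ 2 + C * a ^ 4 * k x ^ 3 := fun x => by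
    rw [hρsq]
    have h1 := hF (-(a * k x)) (by
      rw [abs_neg, abs_of_pos (hη x).1]; exact (hη x).2.trans_lt haδ)
    rw [show 1 + -(a * k x) = 1 - a * k x by ring] at h1
    refine h1.trans ?_
    have h2 : k x ^ 4 ≤ k x ^ 3 := pow_le_pow_of_le_one (hk0 x).le (hk1 x) (by norm_num)
    have h3 := mul_le_mul_of_nonneg_left h2 (show 0 ≤ C * a ^ 4 by positivity)
    nlinarith
  have hvle : ∀ x, (ρ x * w x) ^ 2 = c ^ 2 / 4 * a ^ 2 * k x ^ 2 - c ^ 2 / 4 * a ^ 3 * k x ^ 3 :=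
    fun x => by
      rw [mul_pow, hρsq]; simp only [hw]; ring
  have hy : IsHydro f ρ σ w := by
    refine ⟨hρp, ?_, ?_, ⟨1 / 2, by norm_num, hρlow⟩, ?_⟩
    · rw [memLp_two_iff_integrable_sq hσc.aestronglyMeasurable]
      refine ((hki 2 (by norm_num)).const_mul (a ^ 2 * b ^ 2 / 2)).mono'
        (hσc.pow 2).aestronglyMeasurable (Eventually.of_forall fun x => ?_)
      rw [Real.norm_of_nonneg (sq_nonneg _)]
      exact hσle x
    · rw [memLp_two_iff_integrable_sq
        (show Continuous fun x => ρ x * w x by fun_prop).aestronglyMeasurable]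
      simp only [hvle]
      exact ((hki 2 (by norm_num)).const_mul _).sub ((hki 3 (by norm_num)).const_mul _)
    · refine (((hki 2 (by norm_num)).const_mul (c ^ 2 / 4 * a ^ 2)).add
        ((hki 3 (by norm_num)).const_mul (C * a ^ 4))).mono'
        (hf.continuous_F.comp (hρc.pow 2)).aestronglyMeasurable (Eventually.of_forall fun x => ?_)
      rw [Real.norm_of_nonneg (hf.F_nonneg (sq_nonneg _))]
      exact hFle x
  refine ⟨_, ⟨ρ, σ, w, hy, rfl, ?_⟩, ?_⟩
  · rw [← hkI, ← integral_const_mul]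
    congr 1; ext x
    simp only [momentumDensity, hρsq, hw]
    ring
  · rw [← hkI, ← hkI, ← integral_const_mul, ← integral_const_mul,
      ← integral_sub ((hki 2 (by norm_num)).const_mul _) ((hki 3 (by norm_num)).const_mul _),
      ← integral_div]
    refine integral_mono hy.integrable_energyDensity
      ((((hki 2 (by norm_num)).const_mul _).sub ((hki 3 (by norm_num)).const_mul _)).div_const 2)
      fun x => ?_
    simp only [energyDensity, hvle]
    linarith [hσle x, hFle x]

/-- Small momenta are attained with an energy strictly below the sonic line. -/
theorem exists_attained_small (hf : Admissible f) :
    ∃ q₀ > 0, ∃ K > 0, ∀ q, 0 < q → q ≤ q₀ →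
      ∃ e, Attained f e q ∧ e ≤ soundSpeed f * q - K * q ^ (5 / 3 : ℝ) := by
  obtain ⟨C, hC, δ, hδ, hF⟩ := hf.F_le
  have hc := hf.soundSpeed_pos
  set c := soundSpeed f with hcdef
  obtain ⟨J, hJ⟩ : ∃ J, ∫ x, lorentz x ^ 2 = J := ⟨_, rfl⟩
  obtain ⟨I, hI⟩ : ∃ I, ∫ x, lorentz x ^ 3 = I := ⟨_, rfl⟩
  have hJ0 : 0 < J := hJ ▸ integral_lorentz_pow_pos 2 (by norm_num)
  have hI0 : 0 < I := hI ▸ integral_lorentz_pow_pos 3 (by norm_num)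
  -- With amplitude `t²` and inverse width `β t`, this makes the gradient term a quarter of the
  -- cubic gain. The bound `c ^ 2 / (16 * C)` in `A` does the same for the quartic error, and `m t³`
  -- is the momentum.
  set β := Real.sqrt (c ^ 2 * I / (8 * J)) with hβ
  have hβ0 : 0 < β := Real.sqrt_pos.mpr (by positivity)
  have hβsq : β ^ 2 * J = c ^ 2 / 8 * I := by
    rw [hβ, Real.sq_sqrt (by positivity)]
    field_simp
  set m := c * J / (4 * β) with hm
  have hm0 : 0 < m := by positivity
  set A := min (1 / 2) (min (δ / 2) (c ^ 2 / (16 * C))) with hA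
  have hA0 : 0 < A := by positivity
  set K := c ^ 2 * I / (16 * β) / m ^ (5 / 3 : ℝ) with hK
  refine ⟨m * Real.sqrt A ^ 3, by positivity, K, by positivity, fun q hq hq' => ?_⟩
  set t := (q / m) ^ (1 / 3 : ℝ) with ht
  have hqm : 0 < q / m := by positivity
  have ht0 : 0 < t := by positivity
  have ht3 : t ^ 3 = q / m := by
    rw [ht, ← Real.rpow_natCast, ← Real.rpow_mul hqm.le]; norm_num
  have ht5 : t ^ 5 = q ^ (5 / 3 : ℝ) / m ^ (5 / 3 : ℝ) := by
    rw [← Real.div_rpow hq.le hm0.le, ht, ← Real.rpow_natCast, ← Real.rpow_mul hqm.le]; norm_num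
  have htA : t ^ 2 ≤ A := by
    have h1 : t ^ 3 ≤ Real.sqrt A ^ 3 := by rw [ht3, div_le_iff₀ hm0]; linarith
    have h2 : t ≤ Real.sqrt A := le_of_pow_le_pow_left₀ (by norm_num) (Real.sqrt_nonneg _) h1
    calc t ^ 2 ≤ Real.sqrt A ^ 2 := pow_le_pow_left₀ ht0.le h2 2
      _ = A := Real.sq_sqrt hA0.le
  have hA1 : A ≤ 1 / 2 := min_le_left _ _
  have hA2 : A ≤ δ / 2 := (min_le_right _ _).trans (min_le_left _ _)
  have hA3 : C * A ≤ c ^ 2 / 16 := by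
    have : A ≤ c ^ 2 / (16 * C) := (min_le_right _ _).trans (min_le_right _ _)
    rw [le_div_iff₀ (by positivity)] at this
    linarith
  obtain ⟨e, he, hle⟩ := attained_trial hf (a := t ^ 2) (b := β * t) hC hF (by positivity)
    (htA.trans hA1) (by linarith) (by positivity)
  rw [hJ, ← hcdef] at he
  rw [hJ, hI, ← hcdef] at hle
  have hqe : c / 4 * (t ^ 2) ^ 2 * (J / (β * t)) = q := by
    have : q = m * t ^ 3 := by rw [ht3]; field_simp
    rw [this, hm]
    field_simp
  rw [hqe] at he
  refine ⟨e, he, hle.trans ?_⟩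
  have hKt : K * q ^ (5 / 3 : ℝ) = c ^ 2 * I / (16 * β) * t ^ 5 := by
    rw [ht5, hK]; ring
  rw [hKt, ← hqe]
  have h4 : C * t ^ 8 ≤ c ^ 2 / 16 * t ^ 6 := by
    have := mul_le_mul_of_nonneg_right ((mul_le_mul_of_nonneg_left htA hC.le).trans hA3)
      (show 0 ≤ t ^ 6 by positivity)
    linarith
  have h5 := mul_le_mul_of_nonneg_right h4 (show 0 ≤ I / (2 * (β * t)) by positivity)
  have e1 : ((t ^ 2) ^ 2 * (β * t) ^ 2 / 2 + c ^ 2 / 2 * (t ^ 2) ^ 2) * (J / (β * t)) =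
      t ^ 6 * (β ^ 2 * J) / (2 * (β * t)) + c ^ 2 / 2 * (t ^ 2) ^ 2 * (J / (β * t)) := by
    field_simp
  rw [e1, hβsq]
  have e2 : c ^ 2 * I / (16 * β) * t ^ 5 = c ^ 2 * I * t ^ 6 / (16 * (β * t)) := by
    field_simp
  rw [e2]
  have e3 : (c ^ 2 / 4 * (t ^ 2) ^ 3 - C * (t ^ 2) ^ 4) * (I / (β * t)) =
      c ^ 2 * I * t ^ 6 / (4 * (β * t)) - 2 * (C * t ^ 8 * (I / (2 * (β * t)))) := by
    field_simp
  rw [e3]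
  have e4 : c ^ 2 / 16 * t ^ 6 * (I / (2 * (β * t))) = c ^ 2 * I * t ^ 6 / (β * t) / 32 := by
    field_simp
    norm_num
  rw [e4] at h5
  have e5 : t ^ 6 * (c ^ 2 / 8 * I) / (2 * (β * t)) = c ^ 2 * I * t ^ 6 / (β * t) / 16 := by
    field_simp; norm_num
  have e6 : c ^ 2 * I * t ^ 6 / (4 * (β * t)) = c ^ 2 * I * t ^ 6 / (β * t) / 4 := by
    field_simp
  have e7 : c ^ 2 * I * t ^ 6 / (16 * (β * t)) = c ^ 2 * I * t ^ 6 / (β * t) / 16 := by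
    field_simp
  rw [e5, e6, e7]
  have e8 : 0 < c ^ 2 * I * t ^ 6 / (β * t) := by positivity
  linarith

end Trial

/-! ### The lower bound near the sonic line -/

section LowerBound

open Set Filter Topology

variable {f ρ σ w : ℝ → ℝ}

/-- Agmon's inequality on the line. -/
theorem IsPrimitive.sq_le {u g : ℝ → ℝ} (h : IsPrimitive u g) (hu : Integrable fun x => u x ^ 2)
    (hg : Integrable fun x => g x ^ 2) {s : ℝ} (hs : 0 < s) (x : ℝ) :
    u x ^ 2 ≤ s * (∫ y, u y ^ 2) + s⁻¹ * ∫ y, g y ^ 2 := by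
  refine le_of_forall_pos_le_add fun ε hε => ?_
  -- From `x` to a point where `u²` is below `ε`, the loss `-2ug` is at most `s u² + s⁻¹ g²`.
  obtain ⟨y, hy, hyε⟩ := exists_ge_lt_of_integrable hu hε x
  have hp := h.comp_deriv (φ := fun t => t ^ 2) (φ' := fun t => 2 * t)
    (fun t => by simpa using hasDerivAt_pow 2 t) (by fun_prop)
  have e1 := hp.sub_eq x y
  have hi : Integrable fun t => s * u t ^ 2 + s⁻¹ * g t ^ 2 := (hu.const_mul s).add (hg.const_mul _)
  have h1 : -∫ t in x..y, g t • (2 * u t) ≤ ∫ t in x..y, (s * u t ^ 2 + s⁻¹ * g t ^ 2) := by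
    rw [← intervalIntegral.integral_neg]
    refine intervalIntegral.integral_mono_on hy (hp.intervalIntegrable x y).neg
        hi.intervalIntegrable
      fun t _ => ?_
    have h2 : 0 ≤ s⁻¹ * (s * u t + g t) ^ 2 := by positivity
    have h3 : s⁻¹ * (s * u t + g t) ^ 2 = s * u t ^ 2 + s⁻¹ * g t ^ 2 + g t * (2 * u t) := by
      field_simp; ring
    rw [smul_eq_mul]; linarith
  have h4 : ∫ t in x..y, (s * u t ^ 2 + s⁻¹ * g t ^ 2) ≤ ∫ t, (s * u t ^ 2 + s⁻¹ * g t ^ 2) := by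
    rw [intervalIntegral.integral_of_le hy]
    exact setIntegral_le_integral hi (Eventually.of_forall fun t => by positivity)
  rw [integral_add (hu.const_mul s) (hg.const_mul _), integral_const_mul, integral_const_mul] at h4
  linarith

theorem IsHydro.eta_le_energy (hf : Admissible f) (h : IsHydro f ρ σ w) :
    soundSpeed f ^ 2 * ∫ x, (1 - ρ x ^ 2) ^ 2 ≤ 8 * ∫ x, energyDensity f ρ σ w x := by
  rw [← integral_const_mul, ← integral_const_mul]
  refine integral_mono ((h.integrable_eta_sq hf).const_mul _)
    (h.integrable_energyDensity.const_mul _) fun x => ?_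
  have := hf.lower (ρ x ^ 2) (sq_nonneg _)
  simp only [energyDensity]
  nlinarith [sq_nonneg (σ x), sq_nonneg (ρ x * w x)]

theorem IsHydro.deriv_le_energy (hf : Admissible f) (h : IsHydro f ρ σ w) :
    ∫ x, σ x ^ 2 ≤ 2 * ∫ x, energyDensity f ρ σ w x := by
  rw [← integral_const_mul]
  refine integral_mono h.memLp_deriv.integrable_sq
    (h.integrable_energyDensity.const_mul _) fun x => ?_
  have := hf.F_nonneg (sq_nonneg (ρ x))
  simp only [energyDensity]
  nlinarith [sq_nonneg (ρ x * w x)]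

/-- Agmon's inequality for `ρ - 1` with parameter `c_s / 2`, using `|ρ - 1| ≤ |1 - ρ²|`. Small
energy confines the modulus near one. -/
theorem IsHydro.modulus_sub_one_sq_le (hf : Admissible f) (h : IsHydro f ρ σ w) (x : ℝ) :
    soundSpeed f * (ρ x - 1) ^ 2 ≤ 8 * ∫ x, energyDensity f ρ σ w x := by
  have hc := hf.soundSpeed_pos
  have hp : IsPrimitive (fun x => ρ x - 1) σ :=
    ⟨h.prim.locInt, fun x => by rw [h.prim.eq_add x]; ring⟩
  have hle : ∀ x, (ρ x - 1) ^ 2 ≤ (1 - ρ x ^ 2) ^ 2 := fun x => by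
    have := h.rho_pos x
    rw [show (1 - ρ x ^ 2) ^ 2 = (ρ x - 1) ^ 2 * (1 + ρ x) ^ 2 by ring]
    exact le_mul_of_one_le_right (sq_nonneg _) (one_le_pow₀ (by linarith))
  have hi : Integrable fun x => (ρ x - 1) ^ 2 := by
    refine (h.integrable_eta_sq hf).mono' (hp.continuous.pow 2).aestronglyMeasurable
      (Eventually.of_forall fun x => ?_)
    rw [Real.norm_of_nonneg (sq_nonneg _)]
    exact hle x
  have h1 := hp.sq_le hi h.memLp_deriv.integrable_sq (half_pos hc) x
  have h2 := integral_mono hi (h.integrable_eta_sq hf) hle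
  have h3 := h.eta_le_energy hf
  have h4 := h.deriv_le_energy hf
  have h5 := mul_le_mul_of_nonneg_left h1 hc.le
  have h6 : soundSpeed f * (soundSpeed f / 2 * (∫ y, (ρ y - 1) ^ 2) +
      (soundSpeed f / 2)⁻¹ * ∫ y, σ y ^ 2) =
      soundSpeed f ^ 2 * (∫ y, (ρ y - 1) ^ 2) / 2 + 2 * ∫ y, σ y ^ 2 := by
    field_simp
  have h7 := mul_le_mul_of_nonneg_left h2 (sq_nonneg (soundSpeed f))
  linarith

/-- If the modulus is close to one then the energy exceeds the sonic line up to a cubic error. -/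
theorem IsHydro.sonic_le (hf : Admissible f) (h : IsHydro f ρ σ w) {m : ℝ}
    (hρ : ∀ x, 4 / 5 ≤ ρ x ^ 2) (hm : ∀ x, |1 - ρ x ^ 2| ≤ m) :
    (∫ x, σ x ^ 2) / 2 - soundSpeed f ^ 2 / 6 * m * (∫ x, (1 - ρ x ^ 2) ^ 2) ≤
      (∫ x, energyDensity f ρ σ w x) - soundSpeed f * ∫ x, momentumDensity ρ w x := by
  have hσ := h.memLp_deriv.integrable_sq
  have hη := h.integrable_eta_sq hf
  have hp := h.integrable_momentumDensity hf
  rw [← integral_const_mul, ← integral_const_mul, ← integral_div,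
    ← integral_sub (hσ.div_const 2) (hη.const_mul _),
    ← integral_sub h.integrable_energyDensity (hp.const_mul _)]
  refine integral_mono ((hσ.div_const 2).sub (hη.const_mul _))
    (h.integrable_energyDensity.sub (hp.const_mul _)) fun x => ?_
  have hF := hf.lower (ρ x ^ 2) (sq_nonneg _)
  set c := soundSpeed f
  set η := 1 - ρ x ^ 2 with hηd
  have hr := hρ x
  simp only [energyDensity, momentumDensity]
  -- Completing the square in `w` leaves `F - (c²/4) η²/ρ²`; `F` compensates `(c²/4) η²`, and the
  -- excess of `1/ρ²` over one is at most `5m/4`.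
  have h1 : 0 ≤ (ρ x * w x - c * η / (2 * ρ x)) ^ 2 := sq_nonneg _
  have hne := (h.rho_pos x).ne'
  have h2 : (ρ x * w x - c * η / (2 * ρ x)) ^ 2 =
      (ρ x * w x) ^ 2 - c * (η * w x) + c ^ 2 / 4 * (η ^ 2 / ρ x ^ 2) := by
    field_simp; ring
  have hm0 : 0 ≤ m := (abs_nonneg _).trans (hm x)
  have h3 : η ^ 2 / ρ x ^ 2 ≤ η ^ 2 + 5 / 4 * m * η ^ 2 := by
    rw [div_le_iff₀ (by positivity)]
    have h4 : η ≤ m := (le_abs_self _).trans (hm x)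
    have h5 : ρ x ^ 2 = 1 - η := by rw [hηd]; ring
    have h6 : 1 ≤ (1 + 5 / 4 * m) * ρ x ^ 2 := by
      nlinarith [mul_le_mul_of_nonneg_left hr hm0]
    nlinarith [mul_le_mul_of_nonneg_left h6 (sq_nonneg η)]
  have h7 := mul_le_mul_of_nonneg_left h3 (show 0 ≤ c ^ 2 / 4 by positivity)
  have h8 : 0 ≤ c ^ 2 * m * η ^ 2 := by positivity
  linarith

/-- The energy cannot lie much below the sonic line. -/
theorem exists_sonic_lower_bound (hf : Admissible f) :
    ∃ q₀ > 0, ∃ K > 0, ∀ e q, 0 ≤ q → q ≤ q₀ → Attained f e q →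
      soundSpeed f * q - K * q ^ (5 / 3 : ℝ) ≤ e := by
  have hc := hf.soundSpeed_pos
  -- For `e ≤ c q`, the value `1 / 800` forces `|ρ - 1| ≤ 1 / 10`. The number 23 is `8 + 15`, from
  -- the two terms of Agmon's inequality for `η`; the factor 2 dominates `4 / 3` from `hmN`.
  refine ⟨1 / 800, by norm_num, 2 * 23 ^ (2 / 3 : ℝ) * soundSpeed f, by positivity,
    fun e q hq hq' hA => ?_⟩
  have he0 := hA.nonneg hf
  rcases le_total (soundSpeed f * q) e with hle | hle
  · have : 0 ≤ 2 * 23 ^ (2 / 3 : ℝ) * soundSpeed f * q ^ (5 / 3 : ℝ) := by positivity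
    linarith
  obtain ⟨ρ, σ, w, h, rfl, rfl⟩ := hA
  set e := ∫ x, energyDensity f ρ σ w x with he
  set q := ∫ x, momentumDensity ρ w x with hqd
  set c := soundSpeed f with hcd
  have hρ1 : ∀ x, |ρ x - 1| ≤ 1 / 10 := fun x => by
    have h1 := h.modulus_sub_one_sq_le hf x
    rw [← he, ← hcd] at h1
    have h2 : c * (ρ x - 1) ^ 2 ≤ c * (1 / 10) ^ 2 := by
      have := mul_le_mul_of_nonneg_left hq' hc.le
      linarith
    exact abs_le_of_sq_le_sq (le_of_mul_le_mul_left h2 hc) (by norm_num)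
  have hρ2 : ∀ x, 9 / 10 ≤ ρ x ∧ ρ x ≤ 11 / 10 := fun x => by
    have := abs_le.mp (hρ1 x)
    constructor <;> linarith
  set m := ⨆ x, |1 - ρ x ^ 2| with hm
  have hbdd : BddAbove (range fun x => |1 - ρ x ^ 2|) := by
    refine ⟨1, ?_⟩
    rintro _ ⟨x, rfl⟩
    refine abs_le.mpr ⟨?_, ?_⟩ <;> nlinarith [hρ2 x]
  have hmx : ∀ x, |1 - ρ x ^ 2| ≤ m := fun x => le_ciSup hbdd x
  have hm0 : 0 ≤ m := (abs_nonneg _).trans (hmx 0)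
  have hson := h.sonic_le hf (fun x => by nlinarith [hρ2 x]) hmx
  have hN := h.eta_le_energy hf
  rw [← he, ← hqd, ← hcd] at hson
  rw [← he, ← hcd] at hN
  set N := ∫ x, (1 - ρ x ^ 2) ^ 2 with hNd
  set S := ∫ x, σ x ^ 2 with hSd
  have hmN : c ^ 2 / 6 * m * N ≤ 4 / 3 * m * e := by
    have := mul_le_mul_of_nonneg_left hN hm0
    linarith
  -- Below the sonic line the right side of `hson` is nonpositive, so the gradient is itself
  -- controlled by `m e`.
  have hS : S ≤ 3 * m * e := by nlinarith [mul_nonneg hm0 he0]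
  have hηp := h.prim.comp_deriv (φ := fun t => 1 - t ^ 2) (φ' := fun t => -(2 * t))
    (fun t => by simpa using (hasDerivAt_pow 2 t).const_sub 1) (by fun_prop)
  have hgle : ∀ x, (σ x • -(2 * ρ x)) ^ 2 ≤ 5 * σ x ^ 2 := fun x => by
    rw [smul_eq_mul, mul_pow, mul_comm]
    exact mul_le_mul_of_nonneg_right (by nlinarith [hρ2 x]) (sq_nonneg _)
  have hgi : Integrable fun x => (σ x • -(2 * ρ x)) ^ 2 := by
    refine (h.memLp_deriv.integrable_sq.const_mul 5).mono'
      (hηp.locInt.aestronglyMeasurable.pow 2) (Eventually.of_forall fun x => ?_)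
    rw [Real.norm_of_nonneg (sq_nonneg _)]
    exact hgle x
  have hG := integral_mono hgi (h.memLp_deriv.integrable_sq.const_mul 5) hgle
  rw [integral_const_mul, ← hSd] at hG
  have hm32 : m ^ (3 / 2 : ℝ) ≤ 23 * q := by
    rcases hm0.eq_or_lt with h0 | hmpos
    · rw [← h0, Real.zero_rpow (by norm_num)]; linarith
    -- Agmon's inequality for `η` with parameter `c r` balances `‖η‖² ≲ q/c` against `‖η'‖² ≲ m c
    -- q`, giving `m² ≲ q √m`.
    set r := Real.sqrt m with hr
    have hr0 : 0 < r := Real.sqrt_pos.mpr hmpos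
    have hrm : r ^ 2 = m := Real.sq_sqrt hm0
    have hsq : m ^ 2 ≤ 23 * q * r := by
      have hB : ∀ x, |1 - ρ x ^ 2| ≤ Real.sqrt (23 * q * r) := fun x => by
        refine Real.abs_le_sqrt ?_
        have h1 := hηp.sq_le (h.integrable_eta_sq hf) hgi (show 0 < c * r by positivity) x
        rw [← hNd] at h1
        refine h1.trans ?_
        have h2 : (c * r) * N ≤ 8 * q * r := by
          have h3 : c * N ≤ 8 * q := by
            refine le_of_mul_le_mul_left ?_ hc
            linarith
          nlinarith [mul_le_mul_of_nonneg_right h3 hr0.le]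
        have h4 : (c * r)⁻¹ * (∫ y, (σ y • -(2 * ρ y)) ^ 2) ≤ 15 * q * r := by
          rw [inv_mul_le_iff₀ (by positivity)]
          have h5 : 3 * m * e ≤ 3 * m * (c * q) := mul_le_mul_of_nonneg_left hle (by positivity)
          have h6 : c * r * (15 * q * r) = 15 * m * (c * q) := by rw [← hrm]; ring
          linarith
        linarith
      have hmB : m ≤ Real.sqrt (23 * q * r) := ciSup_le hB
      calc m ^ 2 ≤ Real.sqrt (23 * q * r) ^ 2 := pow_le_pow_left₀ hm0 hmB 2
        _ = 23 * q * r := Real.sq_sqrt (by positivity)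
    have h7 : r ^ 3 ≤ 23 * q := by
      refine le_of_mul_le_mul_right ?_ hr0
      calc r ^ 3 * r = (r ^ 2) ^ 2 := by ring
        _ ≤ 23 * q * r := by rw [hrm]; exact hsq
    have h8 : m ^ (3 / 2 : ℝ) = r ^ 3 := by
      rw [hr, Real.sqrt_eq_rpow, ← Real.rpow_natCast, ← Real.rpow_mul hm0]; norm_num
    rw [h8]; exact h7
  have hm23 : m ≤ 23 ^ (2 / 3 : ℝ) * q ^ (2 / 3 : ℝ) := by
    rw [← Real.mul_rpow (by norm_num) hq]
    calc m = (m ^ (3 / 2 : ℝ)) ^ (2 / 3 : ℝ) := by rw [← Real.rpow_mul hm0]; norm_num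
      _ ≤ (23 * q) ^ (2 / 3 : ℝ) := Real.rpow_le_rpow (by positivity) hm32 (by norm_num)
  have hq53 : q ^ (5 / 3 : ℝ) = q ^ (2 / 3 : ℝ) * q := by
    rw [← Real.rpow_add_one' hq (by norm_num)]; norm_num
  have hS0 : 0 ≤ S := integral_nonneg fun x => sq_nonneg _
  have h9 : m * e ≤ (23 ^ (2 / 3 : ℝ) * q ^ (2 / 3 : ℝ)) * (c * q) :=
    mul_le_mul hm23 hle he0 (by positivity)
  have h10 := mul_nonneg hm0 he0
  rw [hq53]
  linarith

end LowerBound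

/-! ### The black soliton and the momentum bound below its energy -/

section BlackSoliton

open Set Filter Topology

variable {f ρ σ w : ℝ → ℝ}

/-- The square root of the potential, as a function of the modulus. -/
noncomputable def sqrtF (f : ℝ → ℝ) (t : ℝ) : ℝ := Real.sqrt (F f (t ^ 2))

/-- The primitive of `sqrtF f` which vanishes at the origin. -/
noncomputable def primSqrtF (f : ℝ → ℝ) (s : ℝ) : ℝ := ∫ t in (0 : ℝ)..s, sqrtF f t

theorem Admissible.continuous_sqrtF (hf : Admissible f) : Continuous (sqrtF f) :=
  Real.continuous_sqrt.comp (hf.continuous_F.comp (continuous_pow 2))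

theorem sqrtF_nonneg (f : ℝ → ℝ) (t : ℝ) : 0 ≤ sqrtF f t := Real.sqrt_nonneg _

theorem Admissible.sqrtF_sq (hf : Admissible f) (t : ℝ) : sqrtF f t ^ 2 = F f (t ^ 2) :=
  Real.sq_sqrt (hf.F_nonneg (sq_nonneg t))

theorem Admissible.sqrtF_pos (hf : Admissible f) {t : ℝ} (ht : t ^ 2 ≠ 1) : 0 < sqrtF f t := by
  refine Real.sqrt_pos.mpr (lt_of_lt_of_le ?_ (hf.lower _ (sq_nonneg t)))
  have := hf.soundSpeed_pos
  have : 1 - t ^ 2 ≠ 0 := sub_ne_zero.mpr ht.symm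
  positivity

theorem Admissible.hasDerivAt_primSqrtF (hf : Admissible f) (s : ℝ) :
    HasDerivAt (primSqrtF f) (sqrtF f s) s :=
  intervalIntegral.integral_hasDerivAt_right (hf.continuous_sqrtF.intervalIntegrable _ _)
    (hf.continuous_sqrtF.stronglyMeasurableAtFilter _ _) hf.continuous_sqrtF.continuousAt

theorem Admissible.continuous_primSqrtF (hf : Admissible f) : Continuous (primSqrtF f) :=
  continuous_iff_continuousAt.mpr fun s => (hf.hasDerivAt_primSqrtF s).continuousAt

theorem Admissible.monotone_primSqrtF (hf : Admissible f) : Monotone (primSqrtF f) :=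
  monotone_of_hasDerivAt_nonneg (fun s => hf.hasDerivAt_primSqrtF s) fun s => sqrtF_nonneg f s

theorem primSqrtF_neg (f : ℝ → ℝ) (s : ℝ) : primSqrtF f (-s) = -primSqrtF f s := by
  have := intervalIntegral.integral_comp_neg (f := sqrtF f) (a := 0) (b := s)
  rw [neg_zero] at this
  rw [primSqrtF, primSqrtF, intervalIntegral.integral_symm, ← this]
  simp only [sqrtF, neg_sq]

theorem IsHydro.exists_ge_modulus_near (hf : Admissible f) (h : IsHydro f ρ σ w) {ε : ℝ}
    (hε : 0 < ε) (x : ℝ) : ∃ y ≥ x, primSqrtF f 1 - ε ≤ primSqrtF f (ρ y) := by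
  have hc := hf.continuous_primSqrtF.tendsto 1
  obtain ⟨δ, hδ, hb⟩ := Metric.eventually_nhds_iff.mp
    (hc.eventually (lt_mem_nhds (show primSqrtF f 1 - ε < primSqrtF f 1 by linarith)))
  obtain ⟨y, hy, hyδ⟩ := exists_ge_lt_of_integrable (h.integrable_eta_sq hf)
    (show 0 < δ ^ 2 by positivity) x
  refine ⟨y, hy, (hb ?_).le⟩
  have h1 := abs_lt_of_sq_lt_sq hyδ hδ.le
  have h2 : |1 - ρ y ^ 2| = |ρ y - 1| * (1 + ρ y) := by
    rw [← abs_of_pos (show 0 < 1 + ρ y by linarith [h.rho_pos y]), ← abs_mul, ← abs_neg]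
    congr 1; ring
  have h3 : |ρ y - 1| ≤ |ρ y - 1| * (1 + ρ y) :=
    le_mul_of_one_le_right (abs_nonneg _) (by linarith [h.rho_pos y])
  rw [Real.dist_eq]
  linarith

/-- The Modica–Mortola argument: `(σ² + F)/2 ≥ |σ| √F` dominates the variation of `primSqrtF f ∘ ρ`.
The modulus comes near one far away on each side of `x`, hence the factor two. -/
theorem IsHydro.two_mul_primSqrtF_sub_le (hf : Admissible f) (h : IsHydro f ρ σ w) (x : ℝ) :
    2 * (primSqrtF f 1 - primSqrtF f (ρ x)) ≤ ∫ x, energyDensity f ρ σ w x := by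
  refine le_of_forall_pos_le_add fun ε hε => ?_
  obtain ⟨y, hy, hyε⟩ := h.exists_ge_modulus_near hf (half_pos hε) x
  obtain ⟨z, hz, hzε⟩ := h.comp_neg.exists_ge_modulus_near hf (half_pos hε) (-x)
  have hp := h.prim.comp_deriv hf.hasDerivAt_primSqrtF hf.continuous_sqrtF
  have hei := h.integrable_energyDensity
  have hle : ∀ t, |σ t • sqrtF f (ρ t)| ≤ energyDensity f ρ σ w t := fun t => by
    have h1 := hf.sqrtF_sq (ρ t)
    rw [smul_eq_mul, energyDensity, ← h1]
    refine abs_le.mpr ⟨?_, ?_⟩ <;>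
      nlinarith [sq_nonneg (σ t + sqrtF f (ρ t)), sq_nonneg (σ t - sqrtF f (ρ t)),
        sq_nonneg (ρ t * w t)]
  have hint : ∀ a b, a ≤ b → |primSqrtF f (ρ b) - primSqrtF f (ρ a)| ≤
      ∫ t in a..b, energyDensity f ρ σ w t := fun a b hab => by
    rw [hp.sub_eq a b]
    refine (intervalIntegral.abs_integral_le_integral_abs hab).trans ?_
    exact intervalIntegral.integral_mono_on hab (hp.intervalIntegrable a b).abs
      hei.intervalIntegrable fun t _ => hle t
  have h1 := (abs_le.mp (hint x y hy)).2
  have h2 := (abs_le.mp (hint (-z) x (by linarith))).1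
  have h3 := intervalIntegral.integral_add_adjacent_intervals
    (hei.intervalIntegrable (a := -z) (b := x)) (hei.intervalIntegrable (a := x) (b := y))
  have h4 : ∫ t in (-z)..y, energyDensity f ρ σ w t ≤ ∫ t, energyDensity f ρ σ w t := by
    rw [intervalIntegral.integral_of_le (by linarith)]
    exact setIntegral_le_integral hei
        (Eventually.of_forall fun t => energyDensity_nonneg hf _ _ _ t)
  linarith

/-- Below the energy of the black soliton the momentum is bounded. -/
theorem exists_momentum_bound (hf : Admissible f) {M : ℝ} (hM : M < 2 * primSqrtF f 1) :
    ∃ B, ∀ e p, Attained f e p → e ≤ M → p ≤ B := by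
  have hc := hf.soundSpeed_pos
  obtain ⟨A, hA⟩ := (isCompact_Icc (a := (0 : ℝ)) (b := 1)).exists_bound_of_continuousOn
    hf.continuous_sqrtF.continuousOn
  set A' := |A| + 1 with hA'
  have hA'0 : 0 < A' := by positivity
  have hH : ∀ s, 0 ≤ s → s ≤ 1 → primSqrtF f s ≤ A' * s := fun s hs hs' => by
    have := intervalIntegral.integral_mono_on hs (hf.continuous_sqrtF.intervalIntegrable 0 s)
      (intervalIntegrable_const (c := A') (μ := volume)) fun t ht =>
        ((le_abs_self _).trans (hA t ⟨ht.1, ht.2.trans hs'⟩)).trans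
          (show A ≤ A' by linarith [le_abs_self A])
    rw [intervalIntegral.integral_const, sub_zero, smul_eq_mul] at this
    rw [primSqrtF]; linarith
  -- A lower bound for the modulus, since `primSqrtF f s ≤ A' s` on the unit interval. Then `c κ`
  -- times the momentum density is at most the energy density.
  set κ := min 1 ((primSqrtF f 1 - M / 2) / A') with hκ
  have hκ0 : 0 < κ := lt_min one_pos (div_pos (by linarith) hA'0)
  refine ⟨M / (soundSpeed f * κ), fun e p hA heM => ?_⟩
  obtain ⟨ρ, σ, w, h, rfl, rfl⟩ := hA
  have hρ : ∀ x, κ ≤ ρ x := fun x => by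
    rcases le_total 1 (ρ x) with h1 | h1
    · exact (min_le_left _ _).trans h1
    · refine (min_le_right _ _).trans ?_
      rw [div_le_iff₀ hA'0]
      have := h.two_mul_primSqrtF_sub_le hf x
      have := hH (ρ x) (h.rho_pos x).le h1
      linarith
  rw [le_div_iff₀ (by positivity), mul_comm]
  refine le_trans ?_ heM
  rw [← integral_const_mul]
  refine integral_mono ((h.integrable_momentumDensity hf).const_mul _) h.integrable_energyDensity
    fun x => ?_
  have hF := hf.lower (ρ x ^ 2) (sq_nonneg _)
  set c := soundSpeed f
  simp only [momentumDensity, energyDensity]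
  have h1 : κ * ((1 - ρ x ^ 2) * w x) ≤ |1 - ρ x ^ 2| * |ρ x * w x| := by
    have h2 : (1 - ρ x ^ 2) * w x ≤ |1 - ρ x ^ 2| * |w x| := by
      rw [← abs_mul]; exact le_abs_self _
    have h3 : κ * |w x| ≤ |ρ x * w x| := by
      rw [abs_mul, abs_of_pos (h.rho_pos x)]
      exact mul_le_mul_of_nonneg_right (hρ x) (abs_nonneg _)
    have h4 := mul_le_mul_of_nonneg_left h3 (abs_nonneg (1 - ρ x ^ 2))
    have h5 := mul_le_mul_of_nonneg_left h2 hκ0.le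
    linarith
  have h6 : 0 ≤ (c / 2 * |1 - ρ x ^ 2| - |ρ x * w x|) ^ 2 := sq_nonneg _
  have h7 := sq_abs (1 - ρ x ^ 2)
  have h8 := sq_abs (ρ x * w x)
  have h9 := mul_le_mul_of_nonneg_left h1 hc.le
  nlinarith [sq_nonneg (σ x)]

/-- Near one `F` vanishes quadratically, and elsewhere on the unit interval it is bounded while `1 -
t²` is not small. This bounds the velocity in the soliton equation. -/
theorem Admissible.exists_sqrtF_le (hf : Admissible f) :
    ∃ A > 0, ∀ t, t ^ 2 ≤ 1 → sqrtF f t ≤ A * (1 - t ^ 2) := by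
  obtain ⟨C, hC, δ, hδ, hF⟩ := hf.F_le
  obtain ⟨M, hM⟩ := (isCompact_Icc (a := (0 : ℝ)) (b := 1)).exists_bound_of_continuousOn
    hf.continuous_F.continuousOn
  set c := soundSpeed f
  set D := c ^ 2 / 4 + C * δ ^ 2 + |M| / δ ^ 2 + 1 with hD
  have hD0 : 0 < D := by positivity
  refine ⟨Real.sqrt D, Real.sqrt_pos.mpr hD0, fun t ht => ?_⟩
  have hy0 : 0 ≤ 1 - t ^ 2 := by linarith
  rw [sqrtF, Real.sqrt_le_left (by positivity), mul_pow, Real.sq_sqrt hD0.le]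
  rcases lt_or_ge (1 - t ^ 2) δ with h | h
  · have h1 := hF (-(1 - t ^ 2)) (by rwa [abs_neg, abs_of_nonneg hy0])
    rw [show 1 + -(1 - t ^ 2) = t ^ 2 by ring] at h1
    have h2 : (1 - t ^ 2) ^ 2 ≤ δ ^ 2 := pow_le_pow_left₀ hy0 h.le 2
    have h3 := mul_le_mul_of_nonneg_right h2 (sq_nonneg (1 - t ^ 2))
    have h4 := mul_le_mul_of_nonneg_left h3 hC.le
    have h5 : 0 ≤ (|M| / δ ^ 2 + 1) * (1 - t ^ 2) ^ 2 := by positivity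
    rw [hD]
    nlinarith
  · have h1 : F f (t ^ 2) ≤ |M| :=
      ((le_abs_self _).trans (hM _ ⟨sq_nonneg t, ht⟩)).trans (le_abs_self M)
    have h2 : δ ^ 2 ≤ (1 - t ^ 2) ^ 2 := pow_le_pow_left₀ hδ.le h 2
    have h3 : |M| ≤ |M| / δ ^ 2 * (1 - t ^ 2) ^ 2 := by
      rw [div_mul_eq_mul_div, le_div_iff₀ (by positivity)]
      exact mul_le_mul_of_nonneg_left h2 (abs_nonneg M)
    have h5 : 0 ≤ (c ^ 2 / 4 + C * δ ^ 2 + 1) * (1 - t ^ 2) ^ 2 := by positivity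
    rw [hD]
    linarith

theorem hasDerivAt_tanh (x : ℝ) : HasDerivAt Real.tanh (1 - Real.tanh x ^ 2) x := by
  have h := (Real.hasDerivAt_sinh x).div (Real.hasDerivAt_cosh x) (Real.cosh_pos x).ne'
  have he : Real.tanh = Real.sinh / Real.cosh := by
    ext y; rw [Real.tanh_eq_sinh_div_cosh]; rfl
  rw [he]
  refine h.congr_deriv ?_
  have := (Real.cosh_pos x).ne'
  simp only [Pi.div_apply]
  field_simp

/-- A global solution of an autonomous equation with positive bounded velocity. -/
theorem exists_hasDerivAt_comp {G : ℝ → ℝ} (hG : Continuous G) (hpos : ∀ y, 0 < G y) {A : ℝ}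
    (hA : ∀ y, G y ≤ A) : ∃ z : ℝ → ℝ, z 0 = 0 ∧ ∀ x, HasDerivAt z (G (z x)) x := by
  have hA0 : 0 < A := (hpos 0).trans_le (hA 0)
  have hc : Continuous fun y => (G y)⁻¹ := hG.inv₀ fun y => (hpos y).ne'
  -- Separation of variables: `Y` is the travel time, onto because `Y' ≥ 1/A`, and the solution is
  -- its inverse.
  set Y : ℝ → ℝ := fun y => ∫ t in (0 : ℝ)..y, (G t)⁻¹ with hY
  have hd : ∀ y, HasDerivAt Y (G y)⁻¹ y := fun y =>
    intervalIntegral.integral_hasDerivAt_right (hc.intervalIntegrable _ _)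
      (hc.stronglyMeasurableAtFilter _ _) hc.continuousAt
  have hY0 : Y 0 = 0 := by simp [hY]
  have hmono : StrictMono Y := strictMono_of_hasDerivAt_pos hd fun y => inv_pos.mpr (hpos y)
  have hlow : Monotone fun y => Y y - A⁻¹ * y := by
    refine monotone_of_hasDerivAt_nonneg (fun y => (hd y).sub ((hasDerivAt_id y).const_mul A⁻¹))
      fun y => ?_
    have := inv_anti₀ (hpos y) (hA y)
    simpa using this
  have hsurj : Function.Surjective Y := by
    refine (continuous_iff_continuousAt.mpr fun y => (hd y).continuousAt).surjective ?_ ?_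
    · refine tendsto_atTop_mono' _ ?_ (tendsto_id.const_mul_atTop (inv_pos.mpr hA0))
      filter_upwards [eventually_ge_atTop 0] with y hy
      have := hlow hy
      simp only [hY0, id] at this ⊢
      linarith
    · refine tendsto_atBot_mono' _ ?_ (tendsto_id.const_mul_atBot (inv_pos.mpr hA0))
      filter_upwards [eventually_le_atBot 0] with y hy
      have := hlow hy
      simp only [hY0, id] at this ⊢
      linarith
  let e := hmono.orderIsoOfSurjective Y hsurj
  have he : ∀ x, Y (e.symm x) = x := fun x => e.apply_symm_apply x
  refine ⟨e.symm, ?_, fun x => ?_⟩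
  · have h1 : e 0 = 0 := hY0
    rw [← h1, e.symm_apply_apply, h1]
  · have := HasDerivAt.of_local_left_inverse e.symm.continuous.continuousAt (hd (e.symm x))
      (inv_pos.mpr (hpos _)).ne' (Eventually.of_forall he)
    rwa [inv_inv] at this

/-- The black soliton. -/
theorem exists_black_soliton (hf : Admissible f) :
    ∃ v ∈ X1 f, v 0 = 0 ∧ energy f v ≤ 2 * primSqrtF f 1 := by
  obtain ⟨A, hA, hle⟩ := hf.exists_sqrtF_le
  have ht1 : ∀ y, 0 < 1 - Real.tanh y ^ 2 := fun y => by linarith [Real.tanh_sq_lt_one y]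
  have htc : Continuous Real.tanh :=
    continuous_iff_continuousAt.mpr fun y => (hasDerivAt_tanh y).continuousAt
  -- Setting `s = tanh z` in `s' = √F(s²)` gives `z' = G(z)` with `G` positive and bounded, so the
  -- solution is global and `|s| < 1`.
  set G : ℝ → ℝ := fun y => sqrtF f (Real.tanh y) / (1 - Real.tanh y ^ 2) with hG
  obtain ⟨z, hz0, hz⟩ := exists_hasDerivAt_comp (G := G) (A := A)
    ((hf.continuous_sqrtF.comp htc).div (by fun_prop) fun y => (ht1 y).ne')
    (fun y => div_pos (hf.sqrtF_pos (by linarith [ht1 y] : Real.tanh y ^ 2 < 1).ne) (ht1 y))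
    (fun y => by
      rw [div_le_iff₀ (ht1 y)]
      exact hle _ (by linarith [ht1 y]))
  set s : ℝ → ℝ := fun x => Real.tanh (z x) with hs
  have hsd : ∀ x, HasDerivAt s (sqrtF f (s x)) x := fun x => by
    refine ((hasDerivAt_tanh (z x)).comp x (hz x)).congr_deriv ?_
    simp only [hG, hs]
    have := (ht1 (z x)).ne'
    field_simp
  have hsc : Continuous s := continuous_iff_continuousAt.mpr fun x => (hsd x).continuousAt
  have hs1 : ∀ x, |s x| ≤ 1 := fun x => (Real.abs_tanh_lt_one _).le
  have hgc : Continuous fun x => sqrtF f (s x) := hf.continuous_sqrtF.comp hsc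
  have hFc : Continuous fun x => F f (s x ^ 2) := hf.continuous_F.comp (hsc.pow 2)
  have hHd : ∀ x, HasDerivAt (fun x => primSqrtF f (s x)) (F f (s x ^ 2)) x := fun x => by
    refine ((hf.hasDerivAt_primSqrtF (s x)).comp x (hsd x)).congr_deriv ?_
    rw [← sq, hf.sqrtF_sq]
  -- Along the solution `F(s²)` is the derivative of `primSqrtF f (s x)`, an odd function of `s`
  -- with `|s| ≤ 1`.
  have hbd : ∀ a b, ∫ x in a..b, F f (s x ^ 2) ≤ 2 * primSqrtF f 1 := fun a b => by
    rw [intervalIntegral.integral_eq_sub_of_hasDerivAt (fun x _ => hHd x)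
      (hFc.intervalIntegrable _ _)]
    have h1 := hf.monotone_primSqrtF (abs_le.mp (hs1 b)).2
    have h2 := hf.monotone_primSqrtF (abs_le.mp (hs1 a)).1
    rw [primSqrtF_neg] at h2
    linarith
  have hbot : Tendsto (fun n : ℝ => -n) atTop atBot := tendsto_neg_atTop_atBot
  have hFi : Integrable fun x => F f (s x ^ 2) := by
    refine integrable_of_intervalIntegral_norm_bounded (2 * primSqrtF f 1)
      (fun n : ℝ => (hFc.integrableOn_Icc).mono_set Ioc_subset_Icc_self) hbot tendsto_id
      (Eventually.of_forall fun n => ?_)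
    simp only [Real.norm_of_nonneg (hf.F_nonneg (sq_nonneg (s _)))]
    exact hbd _ _
  have hFI : ∫ x, F f (s x ^ 2) ≤ 2 * primSqrtF f 1 :=
    le_of_tendsto (intervalIntegral_tendsto_integral hFi hbot tendsto_id)
      (Eventually.of_forall fun n => hbd _ _)
  set u : ℝ → ℂ := fun x => (s x : ℂ) with hu
  set g : ℝ → ℂ := fun x => (sqrtF f (s x) : ℂ) with hg
  have hup : IsPrimitive u g :=
    IsPrimitive.of_hasDerivAt (fun x => (hsd x).ofReal_comp) (Complex.continuous_ofReal.comp hgc)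
  have hun : ∀ x, ‖u x‖ ^ 2 = s x ^ 2 := fun x => by simp [hu]
  have hgn : ∀ x, ‖g x‖ ^ 2 = F f (s x ^ 2) := fun x => by simp [hg, hf.sqrtF_sq]
  have hgL : MemLp g 2 := by
    rw [memLp_two_iff_integrable_sq_norm hup.locInt.aestronglyMeasurable]
    simpa only [hgn] using hFi
  have hwd := hup.hasWeakDeriv
  have hae := hwd.weakDeriv_ae_eq
  refine ⟨u, ⟨hup.continuous, ⟨fun K hK => ?_, g, hwd, fun K _ => hgL.restrict K⟩,
    (memLp_congr_ae hae).mpr hgL, by simpa only [hun] using hFi⟩, by simp [hu, hs, hz0], ?_⟩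
  · rw [memLp_two_iff_integrable_sq_norm hup.continuous.aestronglyMeasurable]
    exact (hup.continuous.norm.pow 2).locallyIntegrable.integrableOn_isCompact hK
  · have : ∫ x, ‖weakDeriv u x‖ ^ 2 = ∫ x, F f (s x ^ 2) :=
      integral_congr_ae (hae.mono fun x hx => by simp only [hx, hgn])
    rw [energy, this]
    simp only [hun]
    linarith

end BlackSoliton

/-! ### Concave functions on the half-line -/

section RealAnalysis

open Set

/-- Subtract the chord and take a minimum point of the difference `l`. Applying the hypothesis
between it, the nearer endpoint, where `l = 0`, and the mirror point shows that the minimum is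
nonnegative. -/
theorem concaveOn_Ici_of_midpoint {g : ℝ → ℝ} (hg : Continuous g)
    (hmid : ∀ z h, 0 ≤ h → h ≤ z → g (z - h) + g (z + h) ≤ 2 * g z) :
    ConcaveOn ℝ (Ici 0) g := by
  refine LinearOrder.concaveOn_of_lt (convex_Ici 0) fun x hx y hy hxy a b ha hb hab => ?_
  set k := (g y - g x) / (y - x) with hk
  have hyx : y - x ≠ 0 := (sub_pos.mpr hxy).ne'
  set l : ℝ → ℝ := fun t => g t - (g x + (t - x) * k) with hl
  have hlx : l x = 0 := by simp [hl]
  have hly : l y = 0 := by simp only [hl, hk]; field_simp; ring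
  have hlc : Continuous l := by fun_prop
  obtain ⟨z, hz, hmin⟩ := isCompact_Icc.exists_isMinOn (nonempty_Icc.mpr hxy.le) hlc.continuousOn
  have hz0 : 0 ≤ z := le_trans hx hz.1
  have hmidl : ∀ h, 0 ≤ h → h ≤ z → l (z - h) + l (z + h) ≤ 2 * l z := fun h h0 h1 => by
    have := hmid z h h0 h1
    simp only [hl]; linarith
  have hlz : 0 ≤ l z := by
    have hx0 : (0 : ℝ) ≤ x := hx
    rcases le_total (z - x) (y - z) with hle | hle
    · have h1 := hmidl (z - x) (by linarith [hz.1]) (by linarith)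
      have h2 := hmin (show z + (z - x) ∈ Icc x y from ⟨by linarith [hz.1], by linarith⟩)
      rw [sub_sub_cancel, hlx] at h1
      simp only [mem_ofPred_eq] at h2
      linarith
    · have h1 := hmidl (y - z) (by linarith [hz.2]) (by linarith)
      have h2 := hmin (show z - (y - z) ∈ Icc x y from ⟨by linarith, by linarith [hz.2]⟩)
      rw [add_sub_cancel, hly] at h1
      simp only [mem_ofPred_eq] at h2
      linarith
  have hw : a • x + b • y ∈ Icc x y := by
    simp only [smul_eq_mul]
    have : a = 1 - b := by linarith
    subst this
    constructor <;> nlinarith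
  have h3 : 0 ≤ l (a • x + b • y) := hlz.trans (hmin hw)
  have h4 : (a • x + b • y - x) * k = b * (g y - g x) := by
    simp only [smul_eq_mul, hk]
    have : a = 1 - b := by linarith
    subst this
    field_simp; ring
  simp only [hl, h4] at h3
  simp only [smul_eq_mul] at h3 ⊢
  have : a = 1 - b := by linarith
  subst this
  linarith

theorem concaveOn_three_points {g : ℝ → ℝ} (hg : ConcaveOn ℝ (Ici 0) g) {x y t : ℝ} (hx : 0 ≤ x)
    (hxy : x < y) (hyt : y < t) : (t - y) * g x + (y - x) * g t ≤ (t - x) * g y := by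
  have htx : 0 < t - x := by linarith
  have h := hg.2 (show x ∈ Ici (0 : ℝ) from hx) (show t ∈ Ici (0 : ℝ) from by simp; linarith)
    (show 0 ≤ (t - y) / (t - x) from div_nonneg (by linarith) htx.le)
    (show 0 ≤ (y - x) / (t - x) from div_nonneg (by linarith) htx.le) (by field_simp; ring)
  have e : ((t - y) / (t - x)) • x + ((y - x) / (t - x)) • t = y := by
    simp only [smul_eq_mul]; field_simp; ring
  rw [e, smul_eq_mul, smul_eq_mul, div_mul_eq_mul_div, div_mul_eq_mul_div, ← add_div,
    div_le_iff₀ htx] at h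
  linarith

theorem monotoneOn_of_concaveOn_of_nonneg {g : ℝ → ℝ} (hg : ConcaveOn ℝ (Ici 0) g)
    (h0 : ∀ x, 0 ≤ g x) : MonotoneOn g (Ici 0) := by
  intro x hx y _ hxy
  rcases hxy.eq_or_lt with rfl | hxy
  · rfl
  by_contra! hlt
  have hd : 0 < g x - g y := by linarith
  have hx0 : (0 : ℝ) ≤ x := hx
  -- Concavity and `g t ≥ 0` force `t (g x - g y) ≤ y g x`, which this `t` violates.
  set t := y + 1 + y * g x / (g x - g y) with ht
  have hy0 : 0 < y := by linarith
  have hgx := h0 x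
  have h1 : 0 ≤ y * g x / (g x - g y) := by positivity
  have h2 := concaveOn_three_points hg hx0 hxy (show y < t by linarith)
  have h3 : 0 ≤ (y - x) * g t := mul_nonneg (by linarith) (h0 t)
  have h4 : t * (g x - g y) = (y + 1) * (g x - g y) + y * g x := by
    rw [ht]; field_simp
  have h5 : 0 ≤ x * g y := mul_nonneg hx0 (h0 y)
  have h6 : 0 < (y + 1) * (g x - g y) := by positivity
  nlinarith

end RealAnalysis

/-! ### Properties of the minimization curve -/

section Emin

open Set

variable {f : ℝ → ℝ}

theorem Emin_le (hf : Admissible f) {e p : ℝ} (h : Attained f e p) : Emin f p ≤ e := by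
  rw [Emin_eq_sInf_attained]
  exact csInf_le ⟨0, fun _ h => Attained.nonneg hf h⟩ h

theorem exists_attained (hf : Admissible f) (p : ℝ) : ∃ e, Attained f e p := by
  obtain ⟨q, hq, _, _, h⟩ := exists_attained_small hf
  obtain ⟨_, he, _⟩ := h q hq le_rfl
  obtain ⟨e, he, _⟩ := he.mul_momentum hf (p / q)
  rw [div_mul_cancel₀ _ hq.ne'] at he
  exact ⟨e, he⟩

theorem le_Emin (hf : Admissible f) {b p : ℝ} (h : ∀ e, Attained f e p → b ≤ e) :
    b ≤ Emin f p := by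
  rw [Emin_eq_sInf_attained]
  exact le_csInf (exists_attained hf p) h

theorem exists_attained_lt (hf : Admissible f) {b p : ℝ} (h : Emin f p < b) :
    ∃ e < b, Attained f e p := by
  rw [Emin_eq_sInf_attained] at h
  obtain ⟨e, he, hlt⟩ := exists_lt_of_csInf_lt (exists_attained hf p) h
  exact ⟨e, hlt, he⟩

theorem Emin_nonneg (hf : Admissible f) (p : ℝ) : 0 ≤ Emin f p :=
  le_Emin hf fun _ h => h.nonneg hf

theorem Emin_zero (hf : Admissible f) : Emin f 0 = 0 :=
  le_antisymm (Emin_le hf (attained_zero f)) (Emin_nonneg hf 0)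

theorem Emin_neg (f : ℝ → ℝ) (p : ℝ) : Emin f (-p) = Emin f p := by
  simp only [Emin_eq_sInf_attained]
  congr 1; ext e
  exact ⟨fun h => by simpa using Attained.neg h, fun h => Attained.neg h⟩

theorem Emin_add_le (hf : Admissible f) (p q : ℝ) : Emin f (p + q) ≤ Emin f p + Emin f q := by
  rcases eq_or_ne (p + q) 0 with h0 | h0
  · rw [h0, Emin_zero hf]
    exact add_nonneg (Emin_nonneg hf p) (Emin_nonneg hf q)
  refine le_of_forall_pos_le_add fun ε hε => ?_
  obtain ⟨e, he, hA⟩ := exists_attained_lt hf (lt_add_of_pos_right (Emin f p)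
      (show 0 < ε / 3 by positivity))
  obtain ⟨e', he', hA'⟩ := exists_attained_lt hf (lt_add_of_pos_right (Emin f q)
      (show 0 < ε / 3 by positivity))
  obtain ⟨e'', he'', hA''⟩ := hA.add hf hA' h0 (show 0 < ε / 3 by positivity)
  have := Emin_le hf hA''
  linarith

theorem Emin_nsmul_le (hf : Admissible f) (n : ℕ) (s : ℝ) : Emin f (n * s) ≤ n * Emin f s := by
  induction n with
  | zero => simp [Emin_zero hf]
  | succ n ih =>
    push_cast
    rw [add_mul, one_mul, add_mul, one_mul]
    exact (Emin_add_le hf _ _).trans (by linarith)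

theorem Emin_small_le (hf : Admissible f) :
    ∃ q₀ > 0, ∃ K > 0, ∀ q, 0 ≤ q → q ≤ q₀ →
      Emin f q ≤ soundSpeed f * q - K * q ^ (5 / 3 : ℝ) := by
  obtain ⟨q₀, h0, K, hK, h⟩ := exists_attained_small hf
  refine ⟨q₀, h0, K, hK, fun q hq hq' => ?_⟩
  rcases hq.eq_or_lt with rfl | hq
  · rw [Emin_zero hf, Real.zero_rpow (by norm_num)]; simp
  · obtain ⟨e, he, hle⟩ := h q hq hq'
    exact (Emin_le hf he).trans hle

/-- Split `p` into equal pieces small enough for the trial bound and use subadditivity. -/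
theorem Emin_le_mul_abs (hf : Admissible f) (p : ℝ) : Emin f p ≤ soundSpeed f * |p| := by
  have key : ∀ p, 0 ≤ p → Emin f p ≤ soundSpeed f * p := fun p hp => by
    obtain ⟨q₀, h0, K, hK, h⟩ := Emin_small_le hf
    obtain ⟨n, hn⟩ := exists_nat_gt (p / q₀)
    have hn0 : (0 : ℝ) < n := (div_nonneg hp h0.le).trans_lt hn
    have hs : p / n ≤ q₀ := by
      rw [div_lt_iff₀ h0] at hn
      rw [div_le_iff₀ hn0]; linarith
    have h1 := h (p / n) (by positivity) hs
    have h2 := Emin_nsmul_le hf n (p / n)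
    have h3 : (n : ℝ) * (p / n) = p := by field_simp
    rw [h3] at h2
    have h4 : 0 ≤ K * (p / n) ^ (5 / 3 : ℝ) := by positivity
    have h5 : Emin f (p / n) ≤ soundSpeed f * (p / n) := by linarith
    have h6 := mul_le_mul_of_nonneg_left h5 hn0.le
    calc Emin f p ≤ n * (soundSpeed f * (p / n)) := h2.trans h6
      _ = soundSpeed f * (n * (p / n)) := by ring
      _ = soundSpeed f * p := by rw [h3]
  rcases le_total 0 p with hp | hp
  · rw [abs_of_nonneg hp]; exact key p hp
  · rw [abs_of_nonpos hp, ← Emin_neg]; exact key (-p) (by linarith)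

theorem abs_Emin_sub_le (hf : Admissible f) (p q : ℝ) :
    |Emin f p - Emin f q| ≤ soundSpeed f * |p - q| := by
  have key : ∀ p q, Emin f p - Emin f q ≤ soundSpeed f * |p - q| := fun p q => by
    have h1 := Emin_add_le hf q (p - q)
    rw [add_sub_cancel] at h1
    linarith [Emin_le_mul_abs hf (p - q)]
  refine abs_le.mpr ⟨?_, key p q⟩
  have := key q p
  rw [abs_sub_comm] at this
  linarith

theorem continuous_Emin (hf : Admissible f) : Continuous (Emin f) :=
  (LipschitzWith.of_dist_le_mul (K := ⟨soundSpeed f, hf.soundSpeed_pos.le⟩) fun p q =>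
    abs_Emin_sub_le hf p q).continuous

theorem concaveOn_Emin (hf : Admissible f) : ConcaveOn ℝ (Ici 0) (Emin f) := by
  refine concaveOn_Ici_of_midpoint (continuous_Emin hf) fun z h h0 hz => ?_
  -- Reflection needs a positive momentum `z - h`; at `h = z` the inequality is subadditivity.
  rcases hz.eq_or_lt with rfl | hlt
  · rw [sub_self, Emin_zero hf, zero_add, two_mul]
    exact Emin_add_le hf h h
  refine le_of_forall_pos_le_add fun ε hε => ?_
  obtain ⟨e, he, hA⟩ := exists_attained_lt hf (lt_add_of_pos_right (Emin f z) (half_pos hε))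
  obtain ⟨e₁, e₂, h1, h2, h3⟩ := hA.reflect hf (show 0 < z - h by linarith) (by linarith)
  rw [show 2 * z - (z - h) = z + h by ring] at h2
  have := Emin_le hf h1
  have := Emin_le hf h2
  linarith

theorem monotoneOn_Emin (hf : Admissible f) : MonotoneOn (Emin f) (Ici 0) :=
  monotoneOn_of_concaveOn_of_nonneg (concaveOn_Emin hf) (Emin_nonneg hf)

theorem strictMonoOn_Emin (hf : Admissible f) :
    StrictMonoOn (Emin f) {q : ℝ | 0 ≤ q ∧ (q : EReal) ≤ qStar f} := by
  intro x hx y hy hxy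
  by_contra! hle
  have hx0 : 0 ≤ x := hx.1
  have hyx : Emin f y = Emin f x := le_antisymm hle (monotoneOn_Emin hf hx0 hy.1 hxy.le)
  have hconst : ∀ t, x ≤ t → Emin f t = Emin f x := fun t ht => by
    refine le_antisymm ?_ (monotoneOn_Emin hf hx0 (hx0.trans ht) ht)
    rcases le_or_gt t y with hty | hty
    · exact (monotoneOn_Emin hf (hx0.trans ht) hy.1 hty).trans hle
    · have := concaveOn_three_points (concaveOn_Emin hf) hx0 hxy hty
      rw [hyx] at this
      refine le_of_mul_le_mul_left ?_ (sub_pos.mpr hxy)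
      linarith
  -- Since `x < y ≤ q_*`, some `q > x` belongs to the set defining `q_*`.
  obtain ⟨_, ⟨q, ⟨_, hq⟩, rfl⟩, hxq⟩ := lt_sSup_iff.mp
      ((EReal.coe_lt_coe_iff.mpr hxy).trans_le hy.2)
  have hxq : x < q := EReal.coe_lt_coe_iff.mp hxq
  obtain ⟨v, hv, hv0, hve⟩ := exists_black_soliton hf
  -- Otherwise constancy beyond `x` provides data of arbitrarily large momentum with energy below
  -- some `M < 2 * primSqrtF f 1`, against the momentum bound.
  have hE : 2 * primSqrtF f 1 ≤ Emin f q := by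
    by_contra! hlt
    obtain ⟨M, hM1, hM2⟩ := exists_between hlt
    obtain ⟨B, hB⟩ := exists_momentum_bound hf hM2
    have ht : x ≤ max x (B + 1) := le_max_left _ _
    obtain ⟨e, he, hA⟩ := exists_attained_lt hf (p := max x (B + 1)) (b := M) (by
      rw [hconst _ ht, ← hconst q hxq.le]; exact hM1)
    have h1 := hB _ _ hA he.le
    have h2 := le_max_right x (B + 1)
    linarith
  have hpos := hq v hv (hve.trans hE)
  have h0 : ⨅ x, ‖v x‖ ≤ ‖v 0‖ := ciInf_le ⟨0, by rintro _ ⟨x, rfl⟩; positivity⟩ 0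
  rw [hv0, norm_zero] at h0
  linarith

theorem exists_Emin_lower_bound (hf : Admissible f) :
    ∃ q₀ > 0, ∃ K > 0, ∀ q, 0 ≤ q → q ≤ q₀ →
      soundSpeed f * q - K * q ^ (5 / 3 : ℝ) ≤ Emin f q := by
  obtain ⟨q₀, h0, K, hK, h⟩ := exists_sonic_lower_bound hf
  exact ⟨q₀, h0, K, hK, fun q hq hq' => le_Emin hf fun e he => h e q hq hq' he⟩

/-- The minimization curve is tangent to the sonic line at the origin. -/
theorem exists_mul_le_Emin (hf : Admissible f) {k : ℝ} (hk : k < soundSpeed f) :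
    ∃ s₀ > 0, ∀ s, 0 < s → s ≤ s₀ → k * s < Emin f s := by
  obtain ⟨q₀, h0, K, hK, h⟩ := exists_Emin_lower_bound hf
  -- For `s ^ (2 / 3) ≤ d` the error term takes at most half of the gap `(c_s - k) s`.
  set d := (soundSpeed f - k) / (2 * K) with hd
  have hd0 : 0 < d := div_pos (by linarith) (by positivity)
  refine ⟨min q₀ (d ^ (3 / 2 : ℝ)), lt_min h0 (by positivity), fun s hs hs' => ?_⟩
  have h1 := h s hs.le (hs'.trans (min_le_left _ _))
  have h2 : s ^ (2 / 3 : ℝ) ≤ d := by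
    calc s ^ (2 / 3 : ℝ) ≤ (d ^ (3 / 2 : ℝ)) ^ (2 / 3 : ℝ) :=
          Real.rpow_le_rpow hs.le (hs'.trans (min_le_right _ _)) (by norm_num)
      _ = d := by rw [← Real.rpow_mul hd0.le]; norm_num
  have h3 : s ^ (5 / 3 : ℝ) = s ^ (2 / 3 : ℝ) * s := by
    rw [← Real.rpow_add_one' hs.le (by norm_num)]; norm_num
  have h4 : K * d = (soundSpeed f - k) / 2 := by rw [hd]; field_simp
  have h5 : K * (s ^ (2 / 3 : ℝ) * s) ≤ (soundSpeed f - k) / 2 * s := by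
    rw [← h4, mul_assoc]
    exact mul_le_mul_of_nonneg_left (mul_le_mul_of_nonneg_right h2 hs.le) hK.le
  rw [h3] at h1
  have h6 : 0 < (soundSpeed f - k) * s := mul_pos (by linarith) hs
  linarith

/-- By concavity and `E_min(0) = 0` the curve lies above its chord to `p + q`. Equality would put
`p` on the chord and make the curve linear up to `p`, with slope below `c_s` by the trial bound,
contradicting tangency to the sonic line. -/
theorem Emin_add_lt_of_pos (hf : Admissible f) {p q : ℝ} (hp : 0 < p) (hq : 0 < q) :
    Emin f (p + q) < Emin f p + Emin f q := by
  by_contra! hle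
  have hconc := concaveOn_Emin hf
  have hE0 := Emin_zero hf
  have hpq : 0 < p + q := by positivity
  set k := Emin f (p + q) / (p + q) with hk
  have hkpq : Emin f (p + q) = k * (p + q) := by rw [hk]; field_simp
  have hlow : ∀ s, 0 < s → s < p + q → k * s ≤ Emin f s := fun s hs hs' => by
    have := concaveOn_three_points hconc le_rfl hs hs'
    rw [hE0, hkpq] at this
    refine le_of_mul_le_mul_left ?_ hpq
    linarith
  have hEp : Emin f p = k * p := by
    have h1 := hlow p hp (by linarith)
    have h2 := hlow q hq (by linarith)
    rw [hkpq] at hle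
    linarith
  have hup : ∀ s, 0 < s → s < p → Emin f s ≤ k * s := fun s hs hs' => by
    have := concaveOn_three_points hconc hs.le hs' (show p < p + q by linarith)
    rw [hEp, hkpq] at this
    refine le_of_mul_le_mul_left ?_ hq
    linarith
  obtain ⟨q₀, h0, K, hK, h⟩ := Emin_small_le hf
  have hkc : k < soundSpeed f := by
    set s := min q₀ (p / 2) with hs
    have hs0 : 0 < s := by positivity
    have hsp : s < p := (min_le_right _ _).trans_lt (by linarith)
    have h1 := h s hs0.le (min_le_left _ _)
    have h2 := hlow s hs0 (by linarith)
    have h3 : 0 < K * s ^ (5 / 3 : ℝ) := by positivity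
    exact lt_of_mul_lt_mul_right (by linarith) hs0.le
  obtain ⟨s₀, hs₀, hs⟩ := exists_mul_le_Emin hf hkc
  have hm : 0 < min s₀ (p / 2) := by positivity
  have h1 := hs (min s₀ (p / 2)) hm (min_le_left _ _)
  have h2 := hup (min s₀ (p / 2)) hm ((min_le_right _ _).trans_lt (by linarith))
  linarith

theorem Emin_abs (f : ℝ → ℝ) (p : ℝ) : Emin f |p| = Emin f p := by
  rcases abs_choice p with h | h <;> rw [h]
  exact Emin_neg f p

/-- Evenness and monotonicity with `|p + q| ≤ |p| + |q|` reduce to positive momenta. -/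
theorem Emin_add_lt (hf : Admissible f) {p q : ℝ} (hp : p ≠ 0) (hq : q ≠ 0) :
    Emin f (p + q) < Emin f p + Emin f q := by
  rw [← Emin_abs f p, ← Emin_abs f q, ← Emin_abs f (p + q)]
  refine lt_of_le_of_lt ?_ (Emin_add_lt_of_pos hf (abs_pos.mpr hp) (abs_pos.mpr hq))
  exact monotoneOn_Emin hf (show (0 : ℝ) ≤ |p + q| from abs_nonneg _)
      (show (0 : ℝ) ≤ |p| + |q| by positivity)
    (abs_add_le p q)

end Emin

end NLS

theorem mainTheorem4 (f : ℝ → ℝ) (hf : ContDiff ℝ 3 f) (hf_one : f 1 = 0)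
    (hf_deriv : deriv f 1 < 0)
    (H1 : ∀ ρ : ℝ, 0 ≤ ρ → NLS.soundSpeed f ^ 2 / 4 * (1 - ρ) ^ 2 ≤ NLS.F f ρ)
    (H2 : ∃ M r : ℝ, 0 ≤ M ∧ 2 ≤ r ∧ ∀ ρ : ℝ, 2 ≤ ρ → NLS.F f ρ ≤ M * |1 - ρ| ^ r) :
    -- `E_min` is the infimum of a non-empty set
    (∀ p : ℝ, ∃ v ∈ NLS.NX1 f, NLS.momentum v = p) ∧
    -- (i)
    (∀ p : ℝ, 0 ≤ NLS.Emin f p) ∧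
    (∀ p : ℝ, NLS.Emin f (-p) = NLS.Emin f p) ∧
    (∀ p q : ℝ, |NLS.Emin f p - NLS.Emin f q| ≤ NLS.soundSpeed f * |p - q|) ∧
    -- (ii)
    MonotoneOn (NLS.Emin f) (Set.Ici 0) ∧
    ConcaveOn ℝ (Set.Ici 0) (NLS.Emin f) ∧
    StrictMonoOn (NLS.Emin f) {q : ℝ | 0 ≤ q ∧ (q : EReal) ≤ NLS.qStar f} ∧
    -- (iii)
    (deriv (deriv f) 1 + 3 * deriv f 1 ≠ 0 →
      ∃ q₀ K₀ K₁ K₂ : ℝ, 0 < q₀ ∧ 0 < K₀ ∧ 0 < K₁ ∧ 0 < K₂ ∧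
        ∀ q ∈ Set.Icc (0 : ℝ) q₀,
          NLS.soundSpeed f * q - K₀ * q ^ (5 / 3 : ℝ) ≤ NLS.Emin f q ∧
          NLS.Emin f q ≤
            NLS.soundSpeed f * q - K₁ * q ^ (5 / 3 : ℝ) + K₂ * q ^ (7 / 3 : ℝ)) ∧
    -- (iv)
    (deriv (deriv f) 1 + 3 * deriv f 1 ≠ 0 →
      ∀ p q : ℝ, p ≠ 0 → q ≠ 0 →
        NLS.Emin f (p + q) < NLS.Emin f p + NLS.Emin f q) := by
  have h : NLS.Admissible f := ⟨hf, hf_one, hf_deriv, H1⟩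
  refine ⟨fun p => ?_, NLS.Emin_nonneg h, NLS.Emin_neg f, NLS.abs_Emin_sub_le h,
    NLS.monotoneOn_Emin h, NLS.concaveOn_Emin h, NLS.strictMonoOn_Emin h, fun _ => ?_,
    fun _ p q hp hq => NLS.Emin_add_lt h hp hq⟩
  · obtain ⟨e, he⟩ := NLS.exists_attained h p
    obtain ⟨v, hv, hp, _⟩ := NLS.attained_iff.mp he
    exact ⟨v, hv, hp⟩
  · obtain ⟨a, ha, K₀, hK₀, hlow⟩ := NLS.exists_Emin_lower_bound h
    obtain ⟨b, hb, K₁, hK₁, hup⟩ := NLS.Emin_small_le h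
    -- The upper bound already holds without the `q ^ (7 / 3)` term, so any positive `K₂` serves.
    refine ⟨min a b, K₀, K₁, 1, lt_min ha hb, hK₀, hK₁, one_pos, fun q hq => ⟨?_, ?_⟩⟩
    · exact hlow q hq.1 (hq.2.trans (min_le_left _ _))
    · have h1 := hup q hq.1 (hq.2.trans (min_le_right _ _))
      have h2 : 0 ≤ 1 * q ^ (7 / 3 : ℝ) := by have := hq.1; positivity
      linarith
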